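/- Let $\mu$ be a finite measure on $\mathbb N=\{0,1,2,\dots\}$ with $\mu(0)>0$ and $\mu(1)=0$. Consider the continuous-time Bienaymé–Galton–Watson process in which individuals behave independently, each individual lives for an exponential time with parameter $\mu(\mathbb N)$ and is then replaced by a random number of children with law $\mu(\mathbb N)^{-1}\mu$, independent of its lifetime. Let $Z_r$ be the number of individuals alive at time $r$, let $\mathbb E_x$ denote expectation when $Z_0=x\in\mathbb N$, and put $\psi_r(s)=\mathbb E_1(s^{Z_r})$, with $\psi_r'$ the derivative in $s$ (if $\mu$ allows explosion, $s^{Z_r}$ and the weight below are read as $0$ when $Z_r=\infty$). Let $n\ge 1$ and $t>0$. When $Z_t\ge n+1$, sample $n+1$ distinct individuals uniformly (without replacement) among those alive at time $t$, and for $1\le k\le n$ let $T_k$ be the coalescence time of the first and the $(k+1)$-th sampled individual, i.e. the infimum of the $u\in(0,t]$ such that the two have the same ancestor alive at time $t-u$ ($\inf\emptyset=\infty$). Then for every $x\in\mathbb N$, every $s\in[0,1)$ and $0<t_1<t_2<\dots<t_n\le t$, the joint density of the coalescence times is given by $$\frac{\mathbb E_x\big(Z_t(Z_t-1)\cdots(Z_t-n)\,s^{Z_t-n-1},\;T_1\in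 dt_1,\dots,T_n\in dt_n\big)}{dt_1\cdots dt_n} = x\,\psi_t'(s)\,\psi_t(s)^{x-1}\prod_{i=1}^n\Big(\psi_{t_i}'(s)\sum_{k\ge2}k(k-1)\mu(k)\,\psi_{t_i}(s)^{k-2}\Big).$$ That is, for every Borel set $A\subseteq\{(t_1,\dots,t_n):0<t_1<\dots<t_n\le t\}$, the expectation of $Z_t(Z_t-1)\cdots(Z_t-n)\,s^{Z_t-n-1}$ on the event $\{(T_1,\dots,T_n)\in A\}$ equals the integral over $A$ of the right-hand side. -/

import Mathlib

open MeasureTheory ProbabilityTheory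
open scoped ENNReal

namespace BGW

/-- Labels of potential individuals. `(j, [])` is the `j`-th founder and `(j, i :: l)` is the
`i`-th child of `(j, l)` (children and founders are numbered from `0`). -/
abbrev Indiv : Type := ℕ × List ℕ

/-- A realization of the marks: every potential individual `v` carries a pair
`(g v).1` (its lifetime) and `(g v).2` (its number of children, born at its death). -/
abbrev Marks : Type := Indiv → ℝ × ℕ

/-- `w` is an ancestor of `v` (every individual counts as an ancestor of itself). -/
def IsAncestor (w v : Indiv) : Prop := w.1 = v.1 ∧ w.2 <:+ v.2

/-- The birth time of an individual: the sum of the lifetimes of its strict ancestors. -/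
def birth (g : Marks) (j : ℕ) : List ℕ → ℝ
  | [] => 0
  | _ :: l => birth g j l + (g (j, l)).1

/-- The individual with founder `j` and the given path is actually born in the process started
from the `x` founders `0, …, x - 1`. -/
def Realized (x : ℕ) (g : Marks) (j : ℕ) : List ℕ → Prop
  | [] => j < x
  | i :: l => Realized x g j l ∧ i < (g (j, l)).2

/-- The individuals alive at time `r` in the process started from `x` founders at time `0`. -/
def population (x : ℕ) (g : Marks) (r : ℝ) : Set Indiv :=
  {v | Realized x g v.1 v.2 ∧ birth g v.1 v.2 ≤ r ∧ r < birth g v.1 v.2 + (g v).1}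

/-- The population size `Z_r` (it is `0` by convention if the population is infinite, i.e. after
an explosion; then the weight `Z (Z - 1) ⋯ (Z - n) s ^ (Z - n - 1)` is read as `0`, in accordance
with `s ^ ∞ = 0`). -/
noncomputable def popSize (x : ℕ) (g : Marks) (r : ℝ) : ℕ := (population x g r).ncard

/-- The law of the marks for the reproduction measure `μ`: all marks are independent, lifetimes are
exponential with parameter `μ(ℕ)`, numbers of children have law `μ(ℕ)⁻¹ μ`, and the lifetime of an
individual is independent of its number of children. -/
noncomputable def markLaw (μ : Measure ℕ) : Measure Marks :=
  Measure.infinitePi fun _ : Indiv =>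
    (expMeasure (μ.real Set.univ)).prod ((μ Set.univ)⁻¹ • μ)

open Classical in
/-- The generating function `ψ_r(s) = E_1(s ^ Z_r)`, where `s ^ Z_r` is read as `s ^ ∞ = 0` if the
population at time `r` is infinite. -/
noncomputable def psi (μ : Measure ℕ) (r s : ℝ) : ℝ :=
  ∫ g, (if (population 1 g r).Finite then s ^ popSize 1 g r else 0) ∂(markLaw μ)

/-- The coalescence time at current time `t` of `v₁` and `v₂`: the infimum of the `u ∈ (0, t]` such
that `v₁` and `v₂` have the same ancestor alive at time `t - u`; it is `⊤` if there is none. -/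
noncomputable def coalescenceTime (x : ℕ) (g : Marks) (t : ℝ) (v₁ v₂ : Indiv) : EReal :=
  sInf ((fun u : ℝ => (u : EReal)) '' {u | 0 < u ∧ u ≤ t ∧
    ∃ w ∈ population x g (t - u), IsAncestor w v₁ ∧ IsAncestor w v₂})

/-- The ordered samples without replacement of `m` individuals alive at time `t`. -/
def samples (x : ℕ) (g : Marks) (t : ℝ) (m : ℕ) : Set (Fin m → Indiv) :=
  {v | Function.Injective v ∧ ∀ i, v i ∈ population x g t}

/-- `σ` is a uniform sample without replacement of `m` individuals of the population at time `t`: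
given the marks, on the event that the population is finite and has at least `m` members, `σ` is
uniformly distributed on the finite set of ordered samples. (Nothing is required off this
event.) -/
structure IsUniformSample {Ω : Type*} [MeasurableSpace Ω] (P : Measure Ω) (x : ℕ) (G : Ω → Marks)
    (t : ℝ) (m : ℕ) (σ : Ω → Fin m → Indiv) : Prop where
  measurableSet_eq : ∀ v, MeasurableSet {ω | σ ω = v}
  cond_law : ∀ B : Set Marks, MeasurableSet B →
    (∀ g ∈ B, (population x g t).Finite ∧ m ≤ popSize x g t) →
    ∀ v, P {ω | G ω ∈ B ∧ σ ω = v} =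
      ∫⁻ g in B, (samples x g t m).indicator
        (fun _ => ((samples x g t m).ncard : ℝ≥0∞)⁻¹) v ∂(P.map G)

end BGW

/-! The factorial weight counts the ordered samples, which are equally likely, so it cancels the
sampling law. The left side becomes the expectation of a sum, over all ordered samples, of `f`
(coalescence times) times `s` to the number of unsampled individuals, where `f` is the indicator of
`A` (`lintegral_uniformSample`). Finite coalescence times force a common founder, so independence of
the founders gives x ψ_t^(x-1) M_t(f), where M_t(f) is the same expectation for a single tree
(`lintegral_sampleSum_population`).

Put λ = μ(ℕ), φ(z) = Σ μ(k) z^k, and D_t = ψ_t'(s), which is the mean over samples of size one. Cut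
the tree at the death of its root, with time r left. Individuals in different subtrees coalesce
exactly at r, the largest possible value. Since the times increase strictly, either the whole sample
lies in one subtree, or the last individual alone lies elsewhere and T_n = r (`treeSum_node_succ`).
Hence (`meanSum_eq`, `meanOne_eq`) M_t(f) = ∫_0^t e^(-λ(t-r)) [φ'(ψ_r) M_r(f) + φ''(ψ_r) D_r
M_r(f(·, r))] dr, D_t = e^(-λt) + ∫_0^t e^(-λ(t-r)) φ'(ψ_r) D_r dr.

By variation of constants, D_t ∫_0^t φ''(ψ_u) M_u(f(·, u)) du solves the first equation too
(`meanOne_mul_lintegral`). Both solutions are bounded on bounded time intervals, so they agree by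
Grönwall (`le_of_volterra`). Induction on n, removing the last time, yields D_t ∏ D_(t_i)
φ''(ψ_(t_i)) (`meanSum_eq_lintegral`). Neither moments of μ nor non-explosion is needed, because s <
1 keeps every quantity finite. -/

namespace BGW

/-! ### Family trees and their decomposition at the root -/

/-- The marks of a single family tree: an individual is given by its path from the founder. -/
abbrev Tree : Type := List ℕ → ℝ × ℕ

namespace Tree

def birth (T : Tree) : List ℕ → ℝ
  | [] => 0
  | _ :: l => birth T l + (T l).1

def Realized (T : Tree) : List ℕ → Prop
  | [] => True
  | i :: l => Realized T l ∧ i < (T l).2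

def alive (T : Tree) (r : ℝ) : Set (List ℕ) :=
  {l | Realized T l ∧ birth T l ≤ r ∧ r < birth T l + (T l).1}

/-- Coalescence time at current time `t` of two individuals with the same founder. -/
noncomputable def coal (T : Tree) (t : ℝ) (p q : List ℕ) : EReal :=
  sInf ((fun u : ℝ => (u : EReal)) '' {u | 0 < u ∧ u ≤ t ∧
    ∃ w ∈ alive T (t - u), w <:+ p ∧ w <:+ q})

/-- The tree with root mark `a` in which the `i`-th child of the root founds the tree `h i`. -/
def node (a : ℝ × ℕ) (h : ℕ → Tree) : Tree := fun l =>
  -- Paths list the most recent generation first, so the index of the child of the root is the last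
  -- entry.
  if hl : l = [] then a else h (l.getLast hl) l.dropLast

@[simp] lemma node_nil (a : ℝ × ℕ) (h : ℕ → Tree) : node a h [] = a := by simp [node]

@[simp] lemma node_concat (a : ℝ × ℕ) (h : ℕ → Tree) (l : List ℕ) (i : ℕ) :
    node a h (l ++ [i]) = h i l := by simp [node]

end Tree

/-- The individuals alive at time `r` in the forest of the first `x` trees of `h`. -/
def forest (x : ℕ) (h : ℕ → Tree) (r : ℝ) : Set (ℕ × List ℕ) :=
  {v | v.1 < x ∧ v.2 ∈ (h v.1).alive r}

/-- The path of the individual `v` of the forest planted on a common root. -/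
def graft (v : ℕ × List ℕ) : List ℕ := v.2 ++ [v.1]

lemma graft_injective : Function.Injective graft := by
  rintro ⟨i, p⟩ ⟨j, q⟩ h
  simp only [graft] at h
  have := List.append_inj' h rfl
  simp_all

lemma nil_ne_graft (v : ℕ × List ℕ) : [] ≠ graft v := by simp [graft]

lemma eq_nil_or_graft (l : List ℕ) : l = [] ∨ ∃ v, l = graft v := by
  rcases List.eq_nil_or_concat l with h | ⟨p, i, h⟩
  · exact .inl h
  · exact .inr ⟨(i, p), by simpa [graft] using h⟩

lemma graft_suffix_graft {v w : ℕ × List ℕ} :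
    graft v <:+ graft w ↔ v.1 = w.1 ∧ v.2 <:+ w.2 := by
  simp only [graft]
  constructor
  · rintro ⟨t, ht⟩
    rw [← List.append_assoc] at ht
    have := List.append_inj' ht rfl
    simp only [List.cons.injEq, and_true] at this
    exact ⟨this.2, t, this.1⟩
  · rintro ⟨h, t, ht⟩
    exact ⟨t, by rw [← List.append_assoc, ht, h]⟩

namespace Tree

@[simp] lemma node_graft (a : ℝ × ℕ) (h : ℕ → Tree) (v : ℕ × List ℕ) :
    node a h (graft v) = h v.1 v.2 := node_concat ..

lemma birth_node (a : ℝ × ℕ) (h : ℕ → Tree) (i : ℕ) (l : List ℕ) :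
    birth (node a h) (graft (i, l)) = a.1 + birth (h i) l := by
  simp only [graft]
  induction l with
  | nil => simp [birth]
  | cons b l ih => simp [birth, ih, add_assoc]

lemma realized_node (a : ℝ × ℕ) (h : ℕ → Tree) (i : ℕ) (l : List ℕ) :
    Realized (node a h) (graft (i, l)) ↔ i < a.2 ∧ Realized (h i) l := by
  simp only [graft]
  induction l with
  | nil => simp [Realized]
  | cons b l ih => simp [Realized, ih, and_assoc]

lemma birth_nonneg {T : Tree} (hT : ∀ l, 0 < (T l).1) (l : List ℕ) : 0 ≤ birth T l := by
  induction l with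
  | nil => simp [birth]
  | cons b l ih => simp only [birth]; linarith [hT l]

lemma alive_of_neg {T : Tree} (hT : ∀ l, 0 < (T l).1) {r : ℝ} (hr : r < 0) : alive T r = ∅ := by
  ext l
  simp only [alive, Set.mem_ofPred_eq, Set.mem_empty_iff_false, iff_false, not_and]
  intro _ h
  linarith [birth_nonneg hT l]

lemma nil_mem_alive {T : Tree} {r : ℝ} : [] ∈ alive T r ↔ 0 ≤ r ∧ r < (T []).1 := by
  simp [alive, Realized, birth]

lemma graft_mem_alive {a : ℝ × ℕ} {h : ℕ → Tree} {r : ℝ} {v : ℕ × List ℕ} :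
    graft v ∈ alive (node a h) r ↔ v ∈ forest a.2 h (r - a.1) := by
  obtain ⟨i, l⟩ := v
  simp only [alive, Set.mem_ofPred_eq, realized_node, birth_node, forest, node_graft, and_assoc]
  refine and_congr_right fun _ => and_congr_right fun _ => and_congr ?_ ?_ <;>
  constructor <;> intro <;> linarith

lemma alive_node_of_lt {a : ℝ × ℕ} {h : ℕ → Tree} (hh : ∀ i l, 0 < (h i l).1) {r : ℝ}
    (hr : 0 ≤ r) (hra : r < a.1) : alive (node a h) r = {[]} := by
  ext l
  rcases eq_nil_or_graft l with rfl | ⟨v, rfl⟩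
  · simp [nil_mem_alive, hr, hra]
  · simp only [graft_mem_alive, forest, Set.mem_ofPred_eq, Set.mem_singleton_iff,
      (nil_ne_graft v).symm, iff_false, not_and]
    rw [alive_of_neg (hh _) (by linarith)]
    simp

lemma alive_node_of_le {a : ℝ × ℕ} {h : ℕ → Tree} {r : ℝ} (hra : a.1 ≤ r) :
    alive (node a h) r = graft '' forest a.2 h (r - a.1) := by
  ext l
  rcases eq_nil_or_graft l with rfl | ⟨v, rfl⟩
  · simp only [nil_mem_alive, node_nil, Set.mem_image, (nil_ne_graft _).symm, and_false,
      exists_false, iff_false, not_and, not_lt]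
    exact fun _ => hra
  · rw [graft_mem_alive, graft_injective.mem_set_image]

/-- Coalescence times are infima that need not be attained: at the branching instant the common
ancestor is already dead, and only larger `u` are admissible. -/
lemma _root_.EReal.le_coe_of_forall_mem_Ioc {x : EReal} {a b : ℝ} (hab : a < b)
    (h : ∀ u : ℝ, a < u → u ≤ b → x ≤ (u : EReal)) : x ≤ (a : EReal) := by
  by_contra! hx
  obtain ⟨c, hac, hcx⟩ := EReal.lt_iff_exists_real_btwn.1 hx
  have hac : a < c := by exact_mod_cast hac
  have h1 := h (min c b) (lt_min hac hab) (min_le_right _ _)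
  have h2 : ((min c b : ℝ) : EReal) ≤ c := by exact_mod_cast min_le_left c b
  exact absurd (h1.trans h2) (not_le.2 hcx)

/-- The root is alive at time 0, so `u = t` is always admissible. -/
lemma coal_le {T : Tree} (hT : ∀ l, 0 < (T l).1) {t : ℝ} (ht : 0 < t) (p q : List ℕ) :
    coal T t p q ≤ (t : EReal) := by
  refine sInf_le ⟨t, ⟨ht, le_rfl, [], ?_, List.nil_suffix, List.nil_suffix⟩, rfl⟩
  simpa [nil_mem_alive] using hT []

/-- As a common ancestor the root only adds values `u > t - a.1`, and by `coal_le` the coalescence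
time inside the subtree is already at most `t - a.1`. -/
lemma coal_node_same {a : ℝ × ℕ} {h : ℕ → Tree} {t : ℝ} (ha : 0 < a.1) (hat : a.1 < t) {i : ℕ}
    (hia : i < a.2) (hi : ∀ l, 0 < (h i l).1) (p q : List ℕ) :
    coal (node a h) t (graft (i, p)) (graft (i, q)) = coal (h i) (t - a.1) p q := by
  apply le_antisymm
  · refine le_sInf ?_
    rintro _ ⟨u, ⟨hu0, hut, w, hw, hwp, hwq⟩, rfl⟩
    refine sInf_le ⟨u, ⟨hu0, ?_, graft (i, w), ?_, graft_suffix_graft.2 ⟨rfl, hwp⟩,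
      graft_suffix_graft.2 ⟨rfl, hwq⟩⟩, rfl⟩
    · linarith
    · rw [graft_mem_alive, sub_right_comm]
      exact ⟨hia, hw⟩
  · refine le_sInf ?_
    rintro _ ⟨u, ⟨hu0, hut, w, hw, hwp, hwq⟩, rfl⟩
    rcases eq_nil_or_graft w with rfl | ⟨v, rfl⟩
    · rw [nil_mem_alive, node_nil] at hw
      refine (coal_le hi (by linarith) p q).trans ?_
      exact EReal.coe_le_coe_iff.2 (by linarith : t - a.1 ≤ u)
    · rw [graft_mem_alive] at hw
      rw [graft_suffix_graft] at hwp hwq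
      obtain ⟨j, l⟩ := v
      obtain ⟨rfl, hlp⟩ := hwp
      have hl : l ∈ alive (h j) (t - u - a.1) := hw.2
      refine sInf_le ⟨u, ⟨hu0, ?_, l, ?_, hlp, hwq.2⟩, rfl⟩
      · have := hl.2.1
        linarith [birth_nonneg hi l]
      · rwa [sub_right_comm]

/-- The root is the only common ancestor, and it is alive at `t - u` exactly for `t - a.1 < u ≤ t`.
-/
lemma coal_node_ne {a : ℝ × ℕ} {h : ℕ → Tree} {t : ℝ} (ha : 0 < a.1) (hat : a.1 < t) {i j : ℕ}
    (hij : i ≠ j) (p q : List ℕ) :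
    coal (node a h) t (graft (i, p)) (graft (j, q)) = ((t - a.1 : ℝ) : EReal) := by
  apply le_antisymm
  · refine EReal.le_coe_of_forall_mem_Ioc (b := t) (by linarith) fun u hu hut => ?_
    refine sInf_le ⟨u, ⟨by linarith, hut, [], ?_, List.nil_suffix, List.nil_suffix⟩, rfl⟩
    rw [nil_mem_alive, node_nil]
    constructor <;> linarith
  · refine le_sInf ?_
    rintro _ ⟨u, ⟨hu0, hut, w, hw, hwp, hwq⟩, rfl⟩
    rcases eq_nil_or_graft w with rfl | ⟨v, rfl⟩
    · rw [nil_mem_alive, node_nil] at hw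
      exact EReal.coe_le_coe_iff.2 (by linarith : t - a.1 ≤ u)
    · rw [graft_suffix_graft] at hwp hwq
      exact absurd (hwp.1.symm.trans hwq.1) hij

open Classical in
-- Each common ancestor `w` makes an interval of `u` admissible, open on the left, and contributes
-- its left endpoint. The infimum thus runs over countably many `w`, which is what measurability
-- needs.
lemma coal_eq_iInf (T : Tree) (t : ℝ) (p q : List ℕ) :
    coal T t p q = ⨅ w : List ℕ, if Realized T w ∧ (w <:+ p ∧ w <:+ q) ∧
        max 0 (t - birth T w - (T w).1) < min t (t - birth T w)
      then ((max 0 (t - birth T w - (T w).1) : ℝ) : EReal) else ⊤ := by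
  apply le_antisymm
  · refine le_iInf fun w => ?_
    split_ifs with hw
    · obtain ⟨h1, h2, h3⟩ := hw
      refine EReal.le_coe_of_forall_mem_Ioc h3 fun u hu hut => ?_
      obtain ⟨hu0, hu1⟩ := max_lt_iff.1 hu
      obtain ⟨hut0, hut1⟩ := le_min_iff.1 hut
      exact sInf_le ⟨u, ⟨hu0, hut0, w, ⟨h1, by linarith, by linarith⟩, h2⟩, rfl⟩
    · exact le_top
  · refine le_sInf ?_
    rintro _ ⟨u, ⟨hu0, hut, w, hw, hwpq⟩, rfl⟩
    refine (iInf_le _ w).trans ?_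
    obtain ⟨h1, h2, h3⟩ := hw
    have h4 : max 0 (t - birth T w - (T w).1) < u := max_lt hu0 (by linarith)
    rw [if_pos ⟨h1, hwpq, h4.trans_le (le_min hut (by linarith))⟩]
    exact EReal.coe_le_coe_iff.2 h4.le

/-! ### Measurability of populations and coalescence times -/

section Measurability

variable {α : Type*} [MeasurableSpace α] {T : α → Tree} {t : α → ℝ}

lemma measurable_birth (hT : Measurable T) (l : List ℕ) : Measurable fun a => birth (T a) l := by
  induction l with
  | nil => exact measurable_const
  | cons i l ih => exact ih.add (by fun_prop)

lemma measurableSet_realized (hT : Measurable T) (l : List ℕ) :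
    MeasurableSet {a | Realized (T a) l} := by
  induction l with
  | nil => simp [Realized]
  | cons i l ih =>
    have h : Measurable fun a => (T a l).2 := by fun_prop
    exact ih.inter (measurableSet_lt measurable_const h)

lemma measurableSet_mem_alive (hT : Measurable T) (ht : Measurable t) (l : List ℕ) :
    MeasurableSet {a | l ∈ alive (T a) (t a)} := by
  have h : Measurable fun a => (T a l).1 := by fun_prop
  have hb := measurable_birth hT l
  exact (measurableSet_realized hT l).inter
    ((measurableSet_le hb ht).inter (measurableSet_lt ht (hb.add h)))

lemma measurable_coal (hT : Measurable T) (ht : Measurable t) (p q : List ℕ) :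
    Measurable fun a => coal (T a) (t a) p q := by
  classical
  simp only [coal_eq_iInf]
  refine .iInf fun w => ?_
  have h : Measurable fun a => (T a w).1 := by fun_prop
  have hb := measurable_birth hT w
  have hm : Measurable fun a => max 0 (t a - birth (T a) w - (T a w).1) := by fun_prop
  refine Measurable.ite ?_ hm.coe_real_ereal measurable_const
  refine (measurableSet_realized hT w).inter (MeasurableSet.inter (.const _) ?_)
  exact measurableSet_lt hm (by fun_prop)

end Measurability

end Tree

lemma measurableSet_mem_forest {α : Type*} [MeasurableSpace α] {h : α → ℕ → Tree} {t : α → ℝ}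
    (hh : Measurable h) (ht : Measurable t) (x : ℕ) (v : ℕ × List ℕ) :
    MeasurableSet {a | v ∈ forest x (h a) (t a)} :=
  MeasurableSet.inter (.const _) (Tree.measurableSet_mem_alive (by fun_prop) ht v.2)

/-! ### Marks with several founders as forests of trees -/

lemma birth_eq (g : Marks) (j : ℕ) (l : List ℕ) : birth g j l = Tree.birth (fun p => g (j, p)) l := by
  induction l with
  | nil => rfl
  | cons i l ih => simp [birth, Tree.birth, ih]

lemma realized_iff (x : ℕ) (g : Marks) (j : ℕ) (l : List ℕ) :
    Realized x g j l ↔ j < x ∧ Tree.Realized (fun p => g (j, p)) l := by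
  induction l with
  | nil => simp [Realized, Tree.Realized]
  | cons i l ih => simp [Realized, Tree.Realized, ih, and_assoc]

lemma population_eq (x : ℕ) (g : Marks) (r : ℝ) :
    population x g r = forest x (fun j l => g (j, l)) r := by
  ext ⟨j, l⟩
  simp [population, forest, Tree.alive, realized_iff, birth_eq, and_assoc]

lemma coalescenceTime_same {x : ℕ} (g : Marks) (t : ℝ) {j : ℕ} (hj : j < x) (p q : List ℕ) :
    coalescenceTime x g t (j, p) (j, q) = Tree.coal (fun l => g (j, l)) t p q := by
  unfold coalescenceTime Tree.coal
  congr 2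
  ext u
  simp only [population_eq, forest, IsAncestor, Set.mem_ofPred_eq, Prod.exists]
  refine and_congr_right fun _ => and_congr_right fun _ => ?_
  constructor
  · rintro ⟨i, w, ⟨-, hw⟩, ⟨rfl, h1⟩, -, h2⟩
    exact ⟨w, hw, h1, h2⟩
  · rintro ⟨w, hw, h1, h2⟩
    exact ⟨j, w, ⟨hj, hw⟩, ⟨rfl, h1⟩, rfl, h2⟩

/-- The hypothesis covers both different founders and a common founder that does not exist. -/
lemma coalescenceTime_eq_top {x : ℕ} (g : Marks) (t : ℝ) {i j : ℕ} (hij : i = j → x ≤ i)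
    (p q : List ℕ) : coalescenceTime x g t (i, p) (j, q) = ⊤ := by
  unfold coalescenceTime
  convert! sInf_empty
  rw [Set.image_eq_empty, Set.eq_empty_iff_forall_notMem]
  rintro u ⟨-, -, ⟨k, w⟩, hw, h1, h2⟩
  rw [population_eq] at hw
  have hki : k = i := h1.1
  have hkj : k = j := h2.1
  have hk : k < x := hw.1
  have := hij (hki.symm.trans hkj)
  omega

lemma measurable_coalescenceTime (x : ℕ) (t : ℝ) (v w : Indiv) :
    Measurable fun g => coalescenceTime x g t v w := by
  obtain ⟨i, p⟩ := v
  obtain ⟨j, q⟩ := w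
  by_cases h : i = j → x ≤ i
  · simp only [coalescenceTime_eq_top _ t h]
    exact measurable_const
  · push Not at h
    obtain ⟨rfl, hi⟩ := h
    simp only [coalescenceTime_same _ t hi]
    exact Tree.measurable_coal (by fun_prop) measurable_const p q

/-! ### Laws of trees and forests, and the branching property -/

/-- The law of a tree of independent marks with law `ν`. -/
noncomputable def treeLaw (ν : Measure (ℝ × ℕ)) : Measure Tree :=
  Measure.infinitePi fun _ : List ℕ => ν

/-- The law of a sequence of independent trees with law `treeLaw ν`. -/
noncomputable def forestLaw (ν : Measure (ℝ × ℕ)) : Measure (ℕ → Tree) :=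
  Measure.infinitePi fun _ : ℕ => treeLaw ν

section

variable (ν : Measure (ℝ × ℕ)) [IsProbabilityMeasure ν]

instance : IsProbabilityMeasure (treeLaw ν) := by unfold treeLaw; infer_instance

instance : IsProbabilityMeasure (forestLaw ν) := by unfold forestLaw; infer_instance

lemma measurePreserving_curry :
    MeasurePreserving (fun (g : Marks) j l => g (j, l)) (Measure.infinitePi fun _ : Indiv => ν)
      (forestLaw ν) where
  measurable := by fun_prop
  map_eq := Measure.infinitePi_map_curry (fun (_ : ℕ) (_ : List ℕ) => ν)

lemma measurable_node : Measurable fun z : (ℝ × ℕ) × (ℕ → Tree) => Tree.node z.1 z.2 := by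
  refine measurable_pi_lambda _ fun l => ?_
  rcases eq_nil_or_graft l with rfl | ⟨v, rfl⟩
  · simp only [Tree.node_nil]; fun_prop
  · simp only [Tree.node_graft]; fun_prop

/-- Decomposition of a random tree into the mark of its root and the trees of the children. -/
lemma measurePreserving_node :
    MeasurePreserving (fun z : (ℝ × ℕ) × (ℕ → Tree) => Tree.node z.1 z.2)
      (ν.prod (forestLaw ν)) (treeLaw ν) where
  measurable := measurable_node
  map_eq := by
    classical
    refine Measure.eq_infinitePi _ fun s B hB => ?_
    rw [Measure.map_apply measurable_node (.pi s.countable_toSet fun i _ => hB i)]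
    have hm := measurePreserving_curry ν
    set s' : Finset (ℕ × List ℕ) := s.preimage graft graft_injective.injOn
    -- A box splits into a condition on the root and a box for the trees of the children, indexed
    -- through `graft`.
    have hset : (fun z : (ℝ × ℕ) × (ℕ → Tree) => Tree.node z.1 z.2) ⁻¹' (Set.pi s B) =
        (if [] ∈ s then B [] else Set.univ) ×ˢ {h | ∀ v ∈ s', h v.1 v.2 ∈ B (graft v)} := by
      ext ⟨a, h⟩
      simp only [Set.mem_preimage, Set.mem_pi, Set.mem_prod, Set.mem_ofPred_eq]
      constructor
      · intro H
        refine ⟨?_, fun v hv => ?_⟩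
        · split_ifs with h0
          · simpa using H [] h0
          · trivial
        · simpa using H (graft v) (Finset.mem_preimage.1 hv)
      · rintro ⟨H0, H⟩ l hl
        rcases eq_nil_or_graft l with rfl | ⟨v, rfl⟩
        · rw [if_pos (by simpa using hl)] at H0
          simpa using H0
        · simpa using H v (Finset.mem_preimage.2 hl)
    have hmeas : MeasurableSet {h : ℕ → Tree | ∀ v ∈ s', h v.1 v.2 ∈ B (graft v)} := by
      have : {h : ℕ → Tree | ∀ v ∈ s', h v.1 v.2 ∈ B (graft v)} =
          ⋂ v ∈ s', {h | h v.1 v.2 ∈ B (graft v)} := by ext; simp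
      rw [this]
      refine Finset.measurableSet_biInter _ fun v _ => ?_
      have : Measurable fun h : ℕ → Tree => h v.1 v.2 := by fun_prop
      exact this (hB _)
    rw [hset, Measure.prod_prod, ← hm.map_eq, Measure.map_apply hm.measurable hmeas]
    have hbox : (fun (g : Marks) j l => g (j, l)) ⁻¹' {h | ∀ v ∈ s', h v.1 v.2 ∈ B (graft v)} =
        Set.pi s' fun v => B (graft v) := by
      ext; simp [Set.mem_pi]
    rw [hbox, Measure.infinitePi_pi _ fun v _ => hB _]
    -- The root is not in the range of `graft`, so its factor is replaced by 1 here and restored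
    -- below if the box constrains it.
    have h1 : ∏ v ∈ s', ν (B (graft v)) = ∏ l ∈ s, if l = [] then 1 else ν (B l) := by
      rw [← Finset.prod_preimage graft s graft_injective.injOn]
      · simp [graft, s']
      · intro l _ hl
        rcases eq_nil_or_graft l with rfl | ⟨v, rfl⟩
        · simp
        · exact absurd ⟨v, rfl⟩ hl
    rw [h1]
    by_cases h0 : [] ∈ s
    · rw [if_pos h0, ← Finset.mul_prod_erase s _ h0, ← Finset.mul_prod_erase s _ h0]
      simp only [if_true, one_mul]
      congr 1
      exact Finset.prod_congr rfl fun l hl => by simp [(Finset.mem_erase.1 hl).1]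
    · rw [if_neg h0, measure_univ, one_mul]
      exact Finset.prod_congr rfl fun l hl => by
        rw [if_neg]; rintro rfl; exact h0 hl

lemma ae_lifetime_pos (hν : ∀ᵐ a ∂ν, 0 < a.1) : ∀ᵐ T ∂treeLaw ν, ∀ l, 0 < (T l).1 := by
  rw [ae_all_iff]
  intro l
  exact (measurePreserving_eval_infinitePi (fun _ : List ℕ => ν) l).quasiMeasurePreserving.ae hν

lemma ae_forest_lifetime_pos (hν : ∀ᵐ a ∂ν, 0 < a.1) :
    ∀ᵐ h ∂forestLaw ν, ∀ i l, 0 < (h i l).1 := by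
  rw [ae_all_iff]
  intro i
  exact (measurePreserving_eval_infinitePi
    (fun _ : ℕ => treeLaw ν) i).quasiMeasurePreserving.ae (ae_lifetime_pos ν hν)

lemma lintegral_forest_prod (s : Finset ℕ) (F : ℕ → Tree → ℝ≥0∞) (hF : ∀ i, Measurable (F i)) :
    ∫⁻ h, ∏ i ∈ s, F i (h i) ∂forestLaw ν = ∏ i ∈ s, ∫⁻ T, F i T ∂treeLaw ν := by
  have hi : iIndepFun (fun i (h : ℕ → Tree) => F i (h i)) (forestLaw ν) :=
    iIndepFun_infinitePi hF
  rw [lintegral_prod_eq_prod_lintegral_of_indepFun s _ hi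
    fun i => (hF i).comp (measurable_pi_apply i)]
  refine Finset.prod_congr rfl fun i _ => ?_
  have := (measurePreserving_eval_infinitePi (fun _ : ℕ => treeLaw ν) i).lintegral_comp (hF i)
  exact this

end

/-! ### Weighted sums over ordered samples -/

/-- The weight `s ^ #S`, read as `0` if `S` is infinite. -/
noncomputable def weight {β : Type*} (s : ℝ≥0∞) (S : Set β) : ℝ≥0∞ :=
  open Classical in if S.Finite then s ^ S.ncard else 0

open Classical in
/-- The sum, over the ordered samples `v` without replacement of size `m` from `S`, of `C v` times
the weight of the individuals that are not sampled. -/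
noncomputable def sampleSum {β : Type*} {m : ℕ} (s : ℝ≥0∞) (S : Set β) (C : (Fin m → β) → ℝ≥0∞) :
    ℝ≥0∞ :=
  ∑' v : Fin m → β, if Function.Injective v ∧ ∀ k, v k ∈ S then
    C v * weight s (S \ Set.range v) else 0

section Weight

variable {β γ : Type*} {s : ℝ≥0∞}

@[simp] lemma weight_empty : weight s (∅ : Set β) = 1 := by simp [weight]

lemma weight_image {φ : β → γ} (hφ : Function.Injective φ) (S : Set β) :
    weight s (φ '' S) = weight s S := by
  classical
  unfold weight
  rw [Set.ncard_image_of_injective S hφ]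
  exact if_congr (Set.finite_image_iff hφ.injOn) rfl rfl

lemma weight_union {S S' : Set β} (h : Disjoint S S') :
    weight s (S ∪ S') = weight s S * weight s S' := by
  by_cases h1 : S.Finite <;> by_cases h2 : S'.Finite <;>
    simp [weight, Set.finite_union, h1, h2]
  rw [Set.ncard_union_eq h h1 h2, pow_add]

lemma weight_le_one (hs : s ≤ 1) (S : Set β) : weight s S ≤ 1 := by
  unfold weight
  split_ifs
  · exact pow_le_one₀ zero_le hs
  · exact zero_le_one

/-- The weight of a set of pairs is the product of the weights of its slices. -/
lemma weight_slices (x : ℕ) (S : ℕ → Set β) :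
    weight s {v : ℕ × β | v.1 < x ∧ v.2 ∈ S v.1} = ∏ j ∈ Finset.range x, weight s (S j) := by
  induction x with
  | zero => simp
  | succ x ih =>
    rw [Finset.prod_range_succ, ← ih, ← weight_image (Prod.mk_right_injective x) (S x),
      ← weight_union]
    · congr 1
      ext ⟨j, q⟩
      simp only [Set.mem_ofPred_eq, Set.mem_union, Set.mem_image, Prod.mk.injEq]
      constructor
      · rintro ⟨h1, h2⟩
        rcases Nat.lt_succ_iff_lt_or_eq.1 h1 with h | rfl
        · exact .inl ⟨h, h2⟩
        · exact .inr ⟨q, h2, rfl, rfl⟩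
      · rintro (⟨h1, h2⟩ | ⟨q, h2, rfl, rfl⟩)
        · exact ⟨by omega, h2⟩
        · exact ⟨by omega, h2⟩
    · rw [Set.disjoint_left]
      rintro _ ⟨h1, -⟩ ⟨q, -, rfl⟩
      exact lt_irrefl _ h1

lemma measurable_encard {α : Type*} [MeasurableSpace α] [Countable β] {S : α → Set β}
    (hS : ∀ b, MeasurableSet {a | b ∈ S a}) : Measurable fun a => (S a).encard := by
  have hF : ∀ F : Finset β, MeasurableSet {a | S a = F} := by
    intro F
    have : {a | S a = F} = ⋂ b, {a | b ∈ S a ↔ b ∈ F} := by ext; simp [Set.ext_iff]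
    rw [this]
    refine .iInter fun b => ?_
    by_cases hb : b ∈ F
    · simpa [hb] using hS b
    · simp only [hb, iff_false]
      exact (hS b).compl
  refine measurable_to_countable' fun y => ?_
  -- A finite cardinality is reached through countably many finite sets, and the value `⊤` is the
  -- complement of all of them.
  have : (fun a => (S a).encard) ⁻¹' {y} = (⋃ F : Finset β, {a | S a = F ∧ (F.card : ℕ∞) = y}) ∪
      {a | (∀ F : Finset β, S a ≠ F) ∧ y = ⊤} := by
    ext a
    simp only [Set.mem_preimage, Set.mem_singleton_iff, Set.mem_union, Set.mem_iUnion,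
      Set.mem_ofPred_eq]
    constructor
    · intro h
      by_cases hfin : (S a).Finite
      · left
        exact ⟨hfin.toFinset, by simp, by rw [← h, hfin.encard_eq_coe_toFinset_card]⟩
      · right
        refine ⟨fun F hF => hfin (hF ▸ F.finite_toSet), ?_⟩
        rw [← h, Set.encard_eq_top_iff]
        exact hfin
    · rintro (⟨F, h, rfl⟩ | ⟨h, rfl⟩)
      · rw [h, Set.encard_coe_eq_coe_finsetCard]
      · rw [Set.encard_eq_top_iff]
        intro hfin
        exact h hfin.toFinset (by simp)
  have hinf : MeasurableSet {a | ∀ F : Finset β, S a ≠ F} := by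
    have : {a | ∀ F : Finset β, S a ≠ F} = ⋂ F : Finset β, {a | S a = F}ᶜ := by ext; simp
    rw [this]
    exact .iInter fun F => (hF F).compl
  rw [this]
  exact .union (.iUnion fun F => (hF F).inter (.const _)) (hinf.inter (.const _))

open Classical in
lemma measurable_ite_finite {α γ : Type*} [MeasurableSpace α] [MeasurableSpace γ] [Countable β]
    {S : α → Set β} (hS : ∀ b, MeasurableSet {a | b ∈ S a}) (u : ℕ → γ) (c : γ) :
    Measurable fun a => if (S a).Finite then u (S a).ncard else c := by
  have h := (measurable_of_countable fun z : ℕ∞ => if z ≠ ⊤ then u z.toNat else c).comp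
    (measurable_encard hS)
  convert h using 1
  funext a
  by_cases hS : (S a).Finite <;> simp [Set.ncard_def, hS]

lemma measurable_weight {α : Type*} [MeasurableSpace α] [Countable β] {S : α → Set β}
    (hS : ∀ b, MeasurableSet {a | b ∈ S a}) : Measurable fun a => weight s (S a) :=
  measurable_ite_finite hS _ _

lemma measurable_sampleSum {α : Type*} [MeasurableSpace α] [Countable β] {m : ℕ} {S : α → Set β}
    (hS : ∀ b, MeasurableSet {a | b ∈ S a}) {C : α → (Fin m → β) → ℝ≥0∞}
    (hC : ∀ v, Measurable fun a => C a v) : Measurable fun a => sampleSum s (S a) (C a) := by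
  classical
  unfold sampleSum
  refine .tsum fun v => Measurable.ite ?_ ((hC v).mul (measurable_weight fun b => ?_))
    measurable_const
  · have : {a | Function.Injective v ∧ ∀ k, v k ∈ S a} =
        {_a | Function.Injective v} ∩ ⋂ k, {a | v k ∈ S a} := by ext; simp
    rw [this]
    exact MeasurableSet.inter (.const _) (.iInter fun k => hS _)
  · exact MeasurableSet.inter (hS b) (.const _)

lemma sampleSum_congr {m : ℕ} {S : Set β} {C C' : (Fin m → β) → ℝ≥0∞}
    (h : ∀ v, Function.Injective v → (∀ k, v k ∈ S) → C v = C' v) :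
    sampleSum s S C = sampleSum s S C' := by
  unfold sampleSum
  refine tsum_congr fun v => ?_
  split_ifs with hv
  · rw [h v hv.1 hv.2]
  · rfl

lemma sampleSum_image {m : ℕ} {φ : β → γ} (hφ : Function.Injective φ) (S : Set β)
    (C : (Fin m → γ) → ℝ≥0∞) :
    sampleSum s (φ '' S) C = sampleSum s S fun v => C (φ ∘ v) := by
  classical
  unfold sampleSum
  have hinj : Function.Injective fun v : Fin m → β => φ ∘ v := hφ.comp_left
  rw [← hinj.tsum_eq]
  · refine tsum_congr fun v => ?_
    have h1 : (Function.Injective (φ ∘ v) ∧ ∀ k, (φ ∘ v) k ∈ φ '' S) ↔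
        Function.Injective v ∧ ∀ k, v k ∈ S :=
      and_congr (hφ.of_comp_iff v) (forall_congr' fun k => hφ.mem_set_image)
    rw [if_congr h1 rfl rfl, Set.range_comp, ← Set.image_sdiff hφ, weight_image hφ]
  · intro v hv
    by_contra hr
    refine hv (if_neg ?_)
    rintro ⟨-, hv⟩
    choose u _ huv using hv
    exact hr ⟨u, funext huv⟩

end Weight

/-! ### Sample sums over a disjoint union of slices -/

section Slices

variable {β : Type*} {s : ℝ≥0∞}

lemma sampleSum_add {m : ℕ} (S : Set β) (C C' : (Fin m → β) → ℝ≥0∞) :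
    sampleSum s S (fun v => C v + C' v) = sampleSum s S C + sampleSum s S C' := by
  unfold sampleSum
  rw [← ENNReal.tsum_add]
  refine tsum_congr fun v => ?_
  split_ifs
  · rw [add_mul]
  · rw [add_zero]

lemma sampleSum_one (S : Set β) :
    sampleSum s S (fun _ : Fin 1 → β => 1) =
      ∑' q, open Classical in if q ∈ S then weight s (S \ {q}) else 0 := by
  classical
  unfold sampleSum
  rw [← (Equiv.funUnique (Fin 1) β).symm.tsum_eq]
  refine tsum_congr fun q => ?_
  have h : Function.Injective ((Equiv.funUnique (Fin 1) β).symm q) :=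
    Function.injective_of_subsingleton _
  have h2 : Set.range ((Equiv.funUnique (Fin 1) β).symm q) = {q} := by
    ext; simp [eq_comm]
  simp only [h, h2, true_and, one_mul]
  simp

lemma prod_range_ite {x j : ℕ} (hj : j < x) (a : ℝ≥0∞) (b : ℕ → ℝ≥0∞) :
    ∏ i ∈ Finset.range x, (if i = j then a else b i) =
      a * ∏ i ∈ (Finset.range x).erase j, b i := by
  rw [← Finset.mul_prod_erase _ _ (Finset.mem_range.2 hj), if_pos rfl]
  congr 1
  exact Finset.prod_congr rfl fun i hi => if_neg (Finset.ne_of_mem_erase hi)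

/-- Samples of individuals that have all the same founder. -/
lemma sampleSum_slices_same {n x : ℕ} (S : ℕ → Set β) (C : (Fin (n + 1) → ℕ × β) → ℝ≥0∞)
    (hC : ∀ v, C v ≠ 0 → ∀ k, (v k).1 = (v 0).1) :
    sampleSum s {v : ℕ × β | v.1 < x ∧ v.2 ∈ S v.1} C =
      ∑ j ∈ Finset.range x, ∏ i ∈ Finset.range x,
        if i = j then sampleSum s (S j) (fun q => C fun k => (j, q k)) else weight s (S i) := by
  classical
  have hinj : Function.Injective
      fun (z : ℕ × (Fin (n + 1) → β)) (k : Fin (n + 1)) => (z.1, z.2 k) := by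
    rintro ⟨i, p⟩ ⟨j, q⟩ h
    have h1 := fun k => congrFun h k
    simp only [Prod.mk.injEq] at h1
    exact Prod.ext (h1 0).1 (funext fun k => (h1 k).2)
  conv_lhs => unfold sampleSum
  -- By `hC` the summand is supported on samples given by one founder and a tuple of members of its
  -- slice.
  rw [← hinj.tsum_eq, ENNReal.tsum_prod', tsum_eq_sum (s := Finset.range x)]
  · refine Finset.sum_congr rfl fun j hj => ?_
    rw [Finset.mem_range] at hj
    rw [prod_range_ite hj, sampleSum, ← ENNReal.tsum_mul_right]
    refine tsum_congr fun q => ?_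
    have hmem : (Function.Injective (fun k => (j, q k)) ∧
        ∀ k, (j, q k) ∈ {v : ℕ × β | v.1 < x ∧ v.2 ∈ S v.1}) ↔
        (Function.Injective q ∧ ∀ k, q k ∈ S j) := by
      refine and_congr ((Prod.mk_right_injective j).of_comp_iff q) ?_
      simp [hj]
    by_cases hq : Function.Injective q ∧ ∀ k, q k ∈ S j
    swap
    · rw [if_neg hq, zero_mul]
      exact if_neg fun h => hq (hmem.1 h)
    rw [if_pos hq, mul_assoc]
    refine (if_pos (hmem.2 hq)).trans ?_
    congr 1
    rw [← prod_range_ite hj]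
    -- Removing the sample alters only the slice `j`, so `weight_slices` still factorises the
    -- remaining weight.
    have hset : {v : ℕ × β | v.1 < x ∧ v.2 ∈ S v.1} \ Set.range (fun k => (j, q k)) =
        {v : ℕ × β | v.1 < x ∧ v.2 ∈ if v.1 = j then S j \ Set.range q else S v.1} := by
      ext ⟨i, p⟩
      simp only [Set.mem_sdiff, Set.mem_ofPred_eq, Set.mem_range, Prod.mk.injEq]
      by_cases hij : i = j
      · subst hij; simp [and_assoc]
      · simp [hij, Ne.symm hij]
    rw [hset, weight_slices x fun i => if i = j then S j \ Set.range q else S i]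
    exact Finset.prod_congr rfl fun i _ => by split_ifs <;> rfl
  · intro j hj
    rw [Finset.mem_range] at hj
    rw [ENNReal.tsum_eq_zero]
    intro q
    refine if_neg ?_
    rintro ⟨-, h⟩
    exact hj (h 0).1
  · intro v hv
    have hv : C v ≠ 0 := by
      intro h
      simp [h] at hv
    exact ⟨((v 0).1, fun k => (v k).2), funext fun k => Prod.ext (hC v hv k).symm rfl⟩

/-- Samples in which the last individual has its own founder and all the others share another
one. -/
lemma sampleSum_slices_split {n x : ℕ} (S : ℕ → Set β) (C : (Fin (n + 2) → ℕ × β) → ℝ≥0∞)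
    (B : ℕ → (Fin (n + 1) → β) → ℝ≥0∞)
    (hC : ∀ v, C v ≠ 0 → ∃ (i j : ℕ) (q : Fin (n + 1) → β) (p : β), i ≠ j ∧
      v = Fin.snoc (α := fun _ => ℕ × β) (fun k => (i, q k)) (j, p))
    (hCB : ∀ i j q p, i ≠ j → i < x → j < x → (∀ k, q k ∈ S i) →  p ∈ S j →
      C (Fin.snoc (α := fun _ => ℕ × β) (fun k => (i, q k)) (j, p)) = B i q) :
    sampleSum s {v : ℕ × β | v.1 < x ∧ v.2 ∈ S v.1} C =
      ∑ i ∈ Finset.range x, ∑ j ∈ (Finset.range x).erase i, ∏ k ∈ Finset.range x,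
        if k = i then sampleSum s (S i) (B i)
        else if k = j then sampleSum s (S j) (fun _ : Fin 1 → β => 1) else weight s (S k) := by
  classical
  let φ : ℕ × ℕ × (Fin (n + 1) → β) × β → Fin (n + 2) → ℕ × β := fun z =>
    Fin.snoc (α := fun _ => ℕ × β) (fun k => (z.1, z.2.2.1 k)) (z.2.1, z.2.2.2)
  have hinj : Function.Injective φ := by
    rintro ⟨i, j, q, p⟩ ⟨i', j', q', p'⟩ h
    have h1 := Fin.snoc_injective2 h
    have h2 := fun k => congrFun h1.1 k
    simp only [Prod.mk.injEq] at h1 h2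
    obtain rfl := (h2 0).1
    obtain rfl : q = q' := funext fun k => (h2 k).2
    obtain ⟨-, rfl, rfl⟩ := h1
    rfl
  conv_lhs => unfold sampleSum
  -- The samples are parametrised by the two founders, the first individuals, and the last one. As
  -- `B` does not depend on the last individual, the sum factorises.
  rw [← hinj.tsum_eq, ENNReal.tsum_prod', tsum_eq_sum (s := Finset.range x)]
  · refine Finset.sum_congr rfl fun i hi => ?_
    rw [Finset.mem_range] at hi
    rw [ENNReal.tsum_prod', tsum_eq_sum (s := (Finset.range x).erase i)]
    · refine Finset.sum_congr rfl fun j hj => ?_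
      obtain ⟨hji, hj⟩ := Finset.mem_erase.1 hj
      have hj' := hj
      rw [Finset.mem_range] at hj
      have hW : ∀ a b : ℝ≥0∞, ∀ c : ℕ → ℝ≥0∞, ∏ k ∈ Finset.range x,
          (if k = i then a else if k = j then b else c k) =
          a * (b * ∏ k ∈ ((Finset.range x).erase i).erase j, c k) := by
        intro a b c
        rw [prod_range_ite hi, ← Finset.mul_prod_erase _ _ (Finset.mem_erase.2 ⟨hji, hj'⟩),
          if_pos rfl]
        congr 2
        exact Finset.prod_congr rfl fun k hk => if_neg (Finset.ne_of_mem_erase hk)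
      rw [hW, sampleSum_one, sampleSum, ENNReal.tsum_prod', ← ENNReal.tsum_mul_right]
      refine tsum_congr fun q => ?_
      rw [← ENNReal.tsum_mul_right, ← ENNReal.tsum_mul_left]
      refine tsum_congr fun p => ?_
      have hmem : (Function.Injective (φ (i, j, q, p)) ∧
          ∀ k, φ (i, j, q, p) k ∈ {v : ℕ × β | v.1 < x ∧ v.2 ∈ S v.1}) ↔
          (Function.Injective q ∧ ∀ k, q k ∈ S i) ∧ p ∈ S j := by
        rw [and_assoc]
        refine and_congr ?_ ?_
        · simp only [φ]
          rw [Fin.snoc_injective_iff]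
          constructor
          · exact fun h => (Function.Injective.of_comp (f := Prod.mk i) h.1)
          · refine fun h => ⟨(Prod.mk_right_injective i).comp h, ?_⟩
            rintro ⟨k, hk⟩
            exact hji (congrArg Prod.fst hk).symm
        · simp only [φ, Fin.forall_fin_succ', Fin.snoc_castSucc, Fin.snoc_last]
          simp [hi, hj]
      by_cases hq : Function.Injective q ∧ ∀ k, q k ∈ S i
      · by_cases hp : p ∈ S j
        · rw [if_pos hq, if_pos hp]
          refine (if_pos (hmem.2 ⟨hq, hp⟩)).trans ?_
          rw [hCB i j q p hji.symm hi hj hq.2 hp, mul_assoc,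
            ← hW]
          congr 1
          have hset : {v : ℕ × β | v.1 < x ∧ v.2 ∈ S v.1} \ Set.range (φ (i, j, q, p)) =
              {v : ℕ × β | v.1 < x ∧ v.2 ∈ (fun k => if k = i then S i \ Set.range q else
                if k = j then S j \ {p} else S k) v.1} := by
            ext ⟨k, l⟩
            simp only [φ, Set.mem_sdiff, Set.mem_ofPred_eq, Fin.range_snoc, Set.mem_insert_iff,
              Set.mem_range, Prod.mk.injEq]
            by_cases hki : k = i
            · subst hki; simp [hji.symm, and_assoc]
            · by_cases hkj : k = j
              · subst hkj; simp [hji, hji.symm, and_assoc]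
              · simp [hki, hkj, Ne.symm hki]
          rw [hset, weight_slices x fun k => if k = i then S i \ Set.range q else
            if k = j then S j \ {p} else S k]
          exact Finset.prod_congr rfl fun k _ => by split_ifs <;> rfl
        · rw [if_neg hp, zero_mul, mul_zero]
          exact if_neg fun h => hp (hmem.1 h).2
      · rw [if_neg hq, zero_mul]
        exact if_neg fun h => hq (hmem.1 h).1
    · intro j hj
      rw [ENNReal.tsum_eq_zero]
      rintro ⟨q, p⟩
      by_cases hij : j = i
      · have : C (φ (i, j, q, p)) = 0 := by
          by_contra h
          obtain ⟨i', j', q', p', hne, h⟩ := hC _ h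
          have := hinj (a₁ := (i, j, q, p)) (a₂ := (i', j', q', p')) h
          simp only [Prod.mk.injEq] at this
          omega
        simp [this]
      · refine if_neg ?_
        rintro ⟨-, h⟩
        have := (h (Fin.last _)).1
        simp only [φ, Fin.snoc_last] at this
        exact hj (Finset.mem_erase.2 ⟨hij, Finset.mem_range.2 this⟩)
  · intro i hi
    rw [Finset.mem_range] at hi
    rw [ENNReal.tsum_eq_zero]
    rintro ⟨j, q, p⟩
    refine if_neg ?_
    rintro ⟨-, h⟩
    have := (h (Fin.castSucc 0)).1
    simp only [φ, Fin.snoc_castSucc] at this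
    exact hi this
  · intro v hv
    have hv : C v ≠ 0 := by
      intro h
      simp [h] at hv
    obtain ⟨i, j, q, p, -, rfl⟩ := hC v hv
    exact ⟨(i, j, q, p), rfl⟩

end Slices

/-! ### First-branching decomposition of sums over samples -/

/-- The coalescence times of the first individual of `v` with the others. -/
noncomputable def Tree.coals {n : ℕ} (T : Tree) (t : ℝ) (v : Fin (n + 1) → List ℕ) :
    Fin n → EReal :=
  fun k => T.coal t (v 0) (v k.succ)

/-- The sum of `f` over the coalescence times of all samples of size `n + 1` from the individuals of
the tree alive at time `t`. -/
noncomputable def treeSum {n : ℕ} (s : ℝ≥0∞) (t : ℝ) (f : (Fin n → EReal) → ℝ≥0∞) (T : Tree) :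
    ℝ≥0∞ :=
  sampleSum s (T.alive t) fun v => f (T.coals t v)

/-- `f` is supported by the increasing vectors of positive real numbers. -/
def Increasing {n : ℕ} (f : (Fin n → EReal) → ℝ≥0∞) : Prop :=
  ∀ τ, f τ ≠ 0 → StrictMono τ ∧ ∀ i, 0 < τ i ∧ τ i < ⊤

lemma treeSum_node {n : ℕ} {s : ℝ≥0∞} {a : ℝ × ℕ} {h : ℕ → Tree} {t : ℝ}
    (hat : a.1 < t) (f : (Fin n → EReal) → ℝ≥0∞) :
    treeSum s t f (Tree.node a h) = sampleSum s (forest a.2 h (t - a.1))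
      fun v => f ((Tree.node a h).coals t (graft ∘ v)) := by
  rw [treeSum, Tree.alive_node_of_le hat.le, sampleSum_image graft_injective]

lemma coals_node_same {n : ℕ} {a : ℝ × ℕ} {h : ℕ → Tree} {t : ℝ} (ha : 0 < a.1)
    (hat : a.1 < t) (hh : ∀ i l, 0 < (h i l).1) {j : ℕ} (hj : j < a.2)
    (q : Fin (n + 1) → List ℕ) :
    (Tree.node a h).coals t (graft ∘ fun k => (j, q k)) = (h j).coals (t - a.1) q :=
  funext fun k => Tree.coal_node_same ha hat hj (hh j) (q 0) (q k.succ)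

/-- A last individual lying alone in another subtree meets the first one only at the root, which
supplies the last time `t - a.1`. -/
lemma coals_node_split {n : ℕ} {a : ℝ × ℕ} {h : ℕ → Tree} {t : ℝ} (ha : 0 < a.1)
    (hat : a.1 < t) (hh : ∀ i l, 0 < (h i l).1) {i j : ℕ} (hi : i < a.2) (hij : i ≠ j)
    (q : Fin (n + 1) → List ℕ) (p : List ℕ) :
    (Tree.node a h).coals t
        (graft ∘ Fin.snoc (α := fun _ => ℕ × List ℕ) (fun k => (i, q k)) (j, p)) =
      Fin.snoc (α := fun _ => EReal) ((h i).coals (t - a.1) q) ((t - a.1 : ℝ) : EReal) := by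
  funext k
  have h0 : (Fin.snoc (α := fun _ => ℕ × List ℕ) (fun k => (i, q k)) (j, p) : Fin (n + 2) → _) 0
      = (i, q 0) := by
    rw [← Fin.castSucc_zero, Fin.snoc_castSucc (α := fun _ => ℕ × List ℕ)]
  refine Fin.lastCases ?_ (fun k => ?_) k
  · simp only [Tree.coals, Function.comp_apply, h0, Fin.succ_last, Fin.snoc_last]
    exact Tree.coal_node_ne ha hat hij (q 0) p
  · simp only [Tree.coals, Function.comp_apply, h0, Fin.succ_castSucc, Fin.snoc_castSucc]
    exact Tree.coal_node_same ha hat hi (hh i) (q 0) (q k.succ)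

lemma treeSum_node_zero {s : ℝ≥0∞} {a : ℝ × ℕ} {h : ℕ → Tree} {t : ℝ} (ha : 0 < a.1)
    (hat : a.1 < t) (hh : ∀ i l, 0 < (h i l).1) (f : (Fin 0 → EReal) → ℝ≥0∞) :
    treeSum s t f (Tree.node a h) = ∑ j ∈ Finset.range a.2, ∏ i ∈ Finset.range a.2,
      if i = j then treeSum s (t - a.1) f (h j) else weight s ((h i).alive (t - a.1)) := by
  rw [treeSum_node hat]
  unfold forest
  rw [sampleSum_slices_same (S := fun j => (h j).alive (t - a.1))]
  · refine Finset.sum_congr rfl fun j hj => Finset.prod_congr rfl fun i _ => ?_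
    simp only [coals_node_same ha hat hh (Finset.mem_range.1 hj)]
    rfl
  · intro v _ k
    rw [Subsingleton.elim (α := Fin 1) k 0]

/-- Every coalescence time is at most `t - a.1`, with equality when the two individuals lie in
different subtrees. Under strict increase only the last individual can leave the subtree of the
first. The two sums are the cases where it stays and where it leaves. -/
lemma treeSum_node_succ {n : ℕ} {s : ℝ≥0∞} {a : ℝ × ℕ} {h : ℕ → Tree} {t : ℝ} (ha : 0 < a.1)
    (hat : a.1 < t) (hh : ∀ i l, 0 < (h i l).1) {f : (Fin (n + 1) → EReal) → ℝ≥0∞}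
    (hf : Increasing f) :
    treeSum s t f (Tree.node a h) =
      (∑ j ∈ Finset.range a.2, ∏ i ∈ Finset.range a.2,
        if i = j then treeSum s (t - a.1) f (h j) else weight s ((h i).alive (t - a.1))) +
      ∑ i ∈ Finset.range a.2, ∑ j ∈ (Finset.range a.2).erase i, ∏ k ∈ Finset.range a.2,
        if k = i then treeSum s (t - a.1)
          (fun τ => f (Fin.snoc (α := fun _ => EReal) τ ((t - a.1 : ℝ) : EReal))) (h i)
        else if k = j then treeSum (n := 0) s (t - a.1) (fun _ => 1) (h j)
        else weight s ((h k).alive (t - a.1)) := by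
  classical
  rw [treeSum_node hat]
  let C : (Fin (n + 2) → ℕ × List ℕ) → ℝ≥0∞ := fun v => f ((Tree.node a h).coals t (graft ∘ v))
  let same : (Fin (n + 2) → ℕ × List ℕ) → Prop := fun v => ∀ k, (v k).1 = (v 0).1
  let split : (Fin (n + 2) → ℕ × List ℕ) → Prop := fun v =>
    ∃ (i j : ℕ) (q : Fin (n + 1) → List ℕ) (p : List ℕ), i ≠ j ∧
      v = Fin.snoc (α := fun _ => ℕ × List ℕ) (fun k => (i, q k)) (j, p)
  have hsplit_not : ∀ v, split v → ¬ same v := by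
    rintro v ⟨i, j, q, p, hij, rfl⟩ H
    have := H (Fin.last _)
    rw [← Fin.castSucc_zero, Fin.snoc_castSucc (α := fun _ => ℕ × List ℕ),
      Fin.snoc_last] at this
    exact hij this.symm
  have key : sampleSum s (forest a.2 h (t - a.1)) C =
      sampleSum s (forest a.2 h (t - a.1)) (fun v => (if same v then C v else 0) +
        if split v then C v else 0) := by
    refine sampleSum_congr fun v _ hv => ?_
    by_cases h1 : same v
    · rw [if_pos h1, if_neg fun h2 => hsplit_not v h2 h1, add_zero]
    by_cases h2 : split v
    · rw [if_neg h1, if_pos h2, zero_add]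
    rw [if_neg h1, if_neg h2, add_zero]
    by_contra hC
    obtain ⟨hmono, -⟩ := hf _ hC
    -- An earlier individual in another subtree would have the maximal time `t - a.1`, leaving no
    -- room for a larger last time.
    have hlt : ∀ k : Fin n, (v k.succ.castSucc).1 = (v 0).1 := by
      intro k
      by_contra hne
      have e1 : (Tree.node a h).coals t (graft ∘ v) k.castSucc = ((t - a.1 : ℝ) : EReal) :=
        Tree.coal_node_ne ha hat (Ne.symm hne) (v 0).2 _
      have e2 : (Tree.node a h).coals t (graft ∘ v) (Fin.last n) ≤ ((t - a.1 : ℝ) : EReal) := by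
        by_cases hl : (v (Fin.last (n + 1))).1 = (v 0).1
        · have := Tree.coal_node_same ha hat (hv 0).1 (hh (v 0).1) (v 0).2 (v (Fin.last (n + 1))).2
          have e : (Tree.node a h).coals t (graft ∘ v) (Fin.last n) =
              Tree.coal (Tree.node a h) t (graft ((v 0).1, (v 0).2))
                (graft ((v 0).1, (v (Fin.last (n + 1))).2)) :=
            congrArg (fun w => Tree.coal (Tree.node a h) t (graft (v 0)) (graft w))
              (Prod.ext hl rfl :
                v (Fin.last (n + 1)) = ((v 0).1, (v (Fin.last (n + 1))).2))
          rw [e, this]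
          exact Tree.coal_le (hh _) (by linarith) _ _
        · exact (Tree.coal_node_ne ha hat (Ne.symm hl) (v 0).2 _).le
      have e3 := hmono (Fin.castSucc_lt_last k)
      rw [e1] at e3
      exact absurd e2 (not_le.2 e3)
    have hlt' : ∀ k : Fin (n + 1), (v k.castSucc).1 = (v 0).1 := by
      intro k
      refine Fin.cases rfl hlt k
    by_cases hl : (v (Fin.last (n + 1))).1 = (v 0).1
    · exact h1 fun k => Fin.lastCases hl hlt' k
    · refine h2 ⟨(v 0).1, (v (Fin.last (n + 1))).1, fun k => (v k.castSucc).2,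
        (v (Fin.last (n + 1))).2, Ne.symm hl, funext fun k => ?_⟩
      refine Fin.lastCases ?_ (fun k => ?_) k
      · rw [Fin.snoc_last]
      · rw [Fin.snoc_castSucc (α := fun _ => ℕ × List ℕ)]
        exact Prod.ext (hlt' k) rfl
  rw [show sampleSum s (forest a.2 h (t - a.1))
    (fun v => f ((Tree.node a h).coals t (graft ∘ v))) = _ from key, sampleSum_add]
  unfold forest
  congr 1
  · rw [sampleSum_slices_same (S := fun j => (h j).alive (t - a.1))]
    · refine Finset.sum_congr rfl fun j hj => Finset.prod_congr rfl fun i _ => ?_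
      have : ∀ q : Fin (n + 2) → List ℕ, same (fun k => (j, q k)) := fun _ _ => rfl
      simp only [this, if_true, C, coals_node_same ha hat hh (Finset.mem_range.1 hj)]
      rfl
    · intro v hv
      by_contra h
      exact hv (if_neg h)
  · rw [sampleSum_slices_split (S := fun j => (h j).alive (t - a.1)) (B := fun i q =>
      f (Fin.snoc (α := fun _ => EReal) ((h i).coals (t - a.1) q) ((t - a.1 : ℝ) : EReal)))]
    · rfl
    · intro v hv
      by_contra h
      exact hv (if_neg h)
    · intro i j q p hij hi _ _ _
      rw [if_pos ⟨i, j, q, p, hij, rfl⟩]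
      simp only [C, coals_node_split ha hat hh hi hij]

/-! ### Integration over independent trees -/

section

variable (ν : Measure (ℝ × ℕ)) [IsProbabilityMeasure ν]

/-- By independence each of the `x` distinguished trees gives the same product. At `x = 0` the
factor `x` makes the truncated exponent irrelevant. -/
lemma lintegral_forest_same (x : ℕ) {A W : Tree → ℝ≥0∞} (hA : Measurable A) (hW : Measurable W) :
    ∫⁻ h, ∑ j ∈ Finset.range x, ∏ i ∈ Finset.range x, (if i = j then A (h j) else W (h i))
      ∂forestLaw ν = x * (∫⁻ T, W T ∂treeLaw ν) ^ (x - 1) * ∫⁻ T, A T ∂treeLaw ν := by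
  have hF : ∀ j i : ℕ, Measurable fun T => if i = j then A T else W T := by
    intro j i; split_ifs <;> assumption
  have h1 : ∀ (h : ℕ → Tree) (j : ℕ), ∏ i ∈ Finset.range x, (if i = j then A (h j) else W (h i)) =
      ∏ i ∈ Finset.range x, (fun i T => if i = j then A T else W T) i (h i) := by
    intro h j
    refine Finset.prod_congr rfl fun i _ => ?_
    split_ifs with hij
    · simp [hij]
    · simp [hij]
  simp only [h1]
  rw [lintegral_finsetSum]
  · rw [Finset.sum_congr rfl (g := fun _ =>
      (∫⁻ T, A T ∂treeLaw ν) * (∫⁻ T, W T ∂treeLaw ν) ^ (x - 1))]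
    · rw [Finset.sum_const, Finset.card_range, nsmul_eq_mul]
      ring
    · intro j hj
      have := lintegral_forest_prod ν (Finset.range x) (fun i T => if i = j then A T else W T) (hF j)
      rw [this]
      have h2 : ∀ i, ∫⁻ T, (if i = j then A T else W T) ∂treeLaw ν =
          if i = j then ∫⁻ T, A T ∂treeLaw ν else ∫⁻ T, W T ∂treeLaw ν := by
        intro i; split_ifs <;> rfl
      simp only [h2]
      rw [prod_range_ite (Finset.mem_range.1 hj), Finset.prod_const, Finset.card_erase_of_mem hj,
        Finset.card_range]
  · intro j _
    exact Finset.measurable_fun_prod _ fun i _ => (hF j i).comp (measurable_pi_apply i)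

/-- The same computation for the `x (x - 1)` ordered pairs of distinct distinguished trees. -/
lemma lintegral_forest_split (x : ℕ) {A B W : Tree → ℝ≥0∞} (hA : Measurable A)
    (hB : Measurable B) (hW : Measurable W) :
    ∫⁻ h, ∑ i ∈ Finset.range x, ∑ j ∈ (Finset.range x).erase i, ∏ k ∈ Finset.range x,
      (if k = i then A (h i) else if k = j then B (h j) else W (h k)) ∂forestLaw ν =
      x * (x - 1 : ℕ) * (∫⁻ T, W T ∂treeLaw ν) ^ (x - 2) *
        ((∫⁻ T, A T ∂treeLaw ν) * ∫⁻ T, B T ∂treeLaw ν) := by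
  have hF : ∀ i j k : ℕ, Measurable fun T => if k = i then A T else if k = j then B T else W T := by
    intro i j k; split_ifs <;> assumption
  have h1 : ∀ (h : ℕ → Tree) (i j : ℕ), ∏ k ∈ Finset.range x,
      (if k = i then A (h i) else if k = j then B (h j) else W (h k)) =
      ∏ k ∈ Finset.range x,
        (fun k T => if k = i then A T else if k = j then B T else W T) k (h k) := by
    intro h i j
    refine Finset.prod_congr rfl fun k _ => ?_
    split_ifs with hi hj
    · simp [hi]
    · subst hj; simp [hi]
    · simp [hi, hj]
  have hmeas : ∀ i j, Measurable fun h : ℕ → Tree => ∏ k ∈ Finset.range x,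
      (fun k T => if k = i then A T else if k = j then B T else W T) k (h k) := fun i j =>
    Finset.measurable_fun_prod _ fun k _ => (hF i j k).comp (measurable_pi_apply k)
  simp only [h1]
  rw [lintegral_finsetSum _ fun i _ => Finset.measurable_fun_sum _ fun j _ => hmeas i j]
  rw [Finset.sum_congr rfl (g := fun _ => (x - 1 : ℕ) * ((∫⁻ T, A T ∂treeLaw ν) *
    ((∫⁻ T, B T ∂treeLaw ν) * (∫⁻ T, W T ∂treeLaw ν) ^ (x - 2))))]
  · rw [Finset.sum_const, Finset.card_range, nsmul_eq_mul]
    ring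
  · intro i hi
    rw [lintegral_finsetSum _ fun j _ => hmeas i j]
    rw [Finset.sum_congr rfl (g := fun _ => (∫⁻ T, A T ∂treeLaw ν) *
      ((∫⁻ T, B T ∂treeLaw ν) * (∫⁻ T, W T ∂treeLaw ν) ^ (x - 2)))]
    · rw [Finset.sum_const, Finset.card_erase_of_mem hi, Finset.card_range, nsmul_eq_mul]
    · intro j hj
      obtain ⟨hji, hjx⟩ := Finset.mem_erase.1 hj
      rw [lintegral_forest_prod ν (Finset.range x) _ (hF i j)]
      have h2 : ∀ k, ∫⁻ T, (if k = i then A T else if k = j then B T else W T) ∂treeLaw ν =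
          if k = i then ∫⁻ T, A T ∂treeLaw ν else if k = j then ∫⁻ T, B T ∂treeLaw ν
            else ∫⁻ T, W T ∂treeLaw ν := by
        intro k; split_ifs <;> rfl
      simp only [h2]
      rw [prod_range_ite (Finset.mem_range.1 hi), ← Finset.mul_prod_erase _ _ hj, if_pos rfl]
      congr 2
      rw [Finset.prod_congr rfl (g := fun _ => ∫⁻ T, W T ∂treeLaw ν)
        fun k hk => if_neg (Finset.ne_of_mem_erase hk), Finset.prod_const,
        Finset.card_erase_of_mem hj, Finset.card_erase_of_mem hi, Finset.card_range]
      rfl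

end

section Measurability

variable {α : Type*} [MeasurableSpace α] {T : α → Tree} {t : α → ℝ} {s : ℝ≥0∞}

lemma measurable_treeSum {n : ℕ} {f : α → (Fin n → EReal) → ℝ≥0∞} (hT : Measurable T)
    (ht : Measurable t) (hf : Measurable (Function.uncurry f)) :
    Measurable fun a => treeSum s (t a) (f a) (T a) := by
  refine measurable_sampleSum (Tree.measurableSet_mem_alive hT ht) fun v => ?_
  have : Measurable fun a => (a, (T a).coals (t a) v) :=
    measurable_id.prodMk (measurable_pi_lambda _ fun k => Tree.measurable_coal hT ht _ _)
  exact hf.comp this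

lemma measurable_treeSum_right {n : ℕ} {f : (Fin n → EReal) → ℝ≥0∞} (hf : Measurable f) (t : ℝ) :
    Measurable (treeSum s t f) :=
  measurable_treeSum (f := fun _ => f) measurable_id measurable_const (hf.comp measurable_snd)

lemma measurable_weight_alive (hT : Measurable T) (ht : Measurable t) :
    Measurable fun a => weight s ((T a).alive (t a)) :=
  measurable_weight (Tree.measurableSet_mem_alive hT ht)

lemma measurable_weight_alive_right (t : ℝ) :
    Measurable fun T : Tree => weight s (T.alive t) :=
  measurable_weight_alive measurable_id measurable_const

end Measurability

/-! ### Mean sums conditioned on the mark of the root -/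

/-- The generating function of the number of individuals of a tree alive at time `r`. -/
noncomputable def genFun (ν : Measure (ℝ × ℕ)) (s : ℝ≥0∞) (r : ℝ) : ℝ≥0∞ :=
  ∫⁻ T, weight s (T.alive r) ∂treeLaw ν

/-- The expectation of `treeSum`. -/
noncomputable def meanSum {n : ℕ} (ν : Measure (ℝ × ℕ)) (s : ℝ≥0∞) (t : ℝ)
    (f : (Fin n → EReal) → ℝ≥0∞) : ℝ≥0∞ :=
  ∫⁻ T, treeSum s t f T ∂treeLaw ν

/-- The expected sum over samples of size one. -/
noncomputable def meanOne (ν : Measure (ℝ × ℕ)) (s : ℝ≥0∞) (t : ℝ) : ℝ≥0∞ :=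
  meanSum (n := 0) ν s t fun _ => 1

/-- Insert `r` as the last coalescence time. -/
def lastTime {n : ℕ} (f : (Fin (n + 1) → EReal) → ℝ≥0∞) (r : ℝ) : (Fin n → EReal) → ℝ≥0∞ :=
  fun τ => f (Fin.snoc (α := fun _ => EReal) τ (r : EReal))

lemma measurable_lastTime {n : ℕ} {f : (Fin (n + 1) → EReal) → ℝ≥0∞} (hf : Measurable f) :
    Measurable (Function.uncurry (lastTime f)) := by
  refine hf.comp (measurable_pi_lambda _ fun k => ?_)
  refine Fin.lastCases ?_ (fun k => ?_) k
  · simp only [Fin.snoc_last]; exact measurable_fst.coe_real_ereal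
  · simp only [Fin.snoc_castSucc]; fun_prop

section

variable {ν : Measure (ℝ × ℕ)} [IsProbabilityMeasure ν] {s : ℝ≥0∞} {n : ℕ}

lemma measurable_genFun : Measurable (genFun ν s) := by
  unfold genFun
  exact Measurable.lintegral_prod_right'
    (f := fun z : ℝ × Tree => weight s (z.2.alive z.1))
    (measurable_weight_alive measurable_snd measurable_fst)

lemma measurable_meanSum {f : ℝ → (Fin n → EReal) → ℝ≥0∞}
    (hf : Measurable (Function.uncurry f)) : Measurable fun r => meanSum ν s r (f r) := by
  unfold meanSum
  refine Measurable.lintegral_prod_right'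
    (f := fun z : ℝ × Tree => treeSum s z.1 (f z.1) z.2)
    (measurable_treeSum measurable_snd measurable_fst ?_)
  exact hf.comp (by fun_prop : Measurable fun w : (ℝ × Tree) × (Fin n → EReal) => (w.1.1, w.2))

lemma measurable_meanOne : Measurable (meanOne ν s) :=
  measurable_meanSum (f := fun _ _ => 1) measurable_const

lemma lintegral_node {F : Tree → ℝ≥0∞} (hF : Measurable F) :
    ∫⁻ T, F T ∂treeLaw ν = ∫⁻ a, ∫⁻ h, F (Tree.node a h) ∂forestLaw ν ∂ν := by
  rw [← (measurePreserving_node ν).lintegral_comp hF, lintegral_prod]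
  exact (hF.comp (measurable_node)).aemeasurable

lemma sampleSum_singleton_zero {β : Type*} (b : β) (C : (Fin 1 → β) → ℝ≥0∞) :
    sampleSum s {b} C = C fun _ => b := by
  classical
  unfold sampleSum
  rw [tsum_eq_single fun _ => b]
  · rw [if_pos ⟨Function.injective_of_subsingleton _, fun _ => rfl⟩]
    have : ({b} : Set β) \ Set.range (fun _ : Fin 1 => b) = ∅ := by simp
    rw [this, weight_empty, mul_one]
  · intro v hv
    refine if_neg ?_
    rintro ⟨-, h⟩
    exact hv (funext fun k => h k)

lemma sampleSum_singleton_succ {β : Type*} (b : β) (C : (Fin (n + 2) → β) → ℝ≥0∞) :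
    sampleSum s {b} C = 0 := by
  classical
  unfold sampleSum
  rw [ENNReal.tsum_eq_zero]
  intro v
  refine if_neg ?_
  rintro ⟨h1, h2⟩
  have h := h1 ((h2 0).trans (h2 1).symm)
  exact absurd (congrArg Fin.val h) (by simp)

/-- If the root outlives `t`, it is the only possible sample; otherwise the trees of its children
are run for the remaining time. The null event of a lifetime equal to `t` is dropped, since the
decomposition of coalescence times needs `a.1 < t`. -/
lemma meanSum_zero_eq (hν : ∀ᵐ a ∂ν, 0 < a.1) {t : ℝ} (ht : 0 < t) (hνt : ∀ᵐ a ∂ν, a.1 ≠ t)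
    (f : (Fin 0 → EReal) → ℝ≥0∞) :
    meanSum ν s t f = ∫⁻ a, (if t < a.1 then f Fin.elim0 else
      a.2 * genFun ν s (t - a.1) ^ (a.2 - 1) * meanSum ν s (t - a.1) f) ∂ν := by
  have hf : Measurable f := measurable_of_finite f
  rw [meanSum, lintegral_node (measurable_treeSum_right hf _)]
  refine lintegral_congr_ae ?_
  filter_upwards [hν, hνt] with a ha hat
  have hpos := ae_forest_lifetime_pos ν hν
  split_ifs with hta
  · rw [lintegral_congr_ae (g := fun _ => f Fin.elim0), lintegral_const, measure_univ, mul_one]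
    filter_upwards [hpos] with h hh
    rw [treeSum, Tree.alive_node_of_lt hh ht.le hta, sampleSum_singleton_zero]
    congr 1
    exact Subsingleton.elim _ _
  · have hat : a.1 < t := lt_of_le_of_ne (not_lt.1 hta) hat
    have hW : Measurable fun T : Tree => weight s (T.alive (t - a.1)) :=
      measurable_weight_alive measurable_id measurable_const
    rw [meanSum, genFun, ← lintegral_forest_same ν a.2 (measurable_treeSum_right hf _) hW]
    refine lintegral_congr_ae ?_
    filter_upwards [hpos] with h hh
    exact treeSum_node_zero ha hat hh f

/-- A living root alone admits no sample of two or more individuals, hence the value 0. The second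
term comes from a split of the sample at the root. -/
lemma meanSum_succ_eq (hν : ∀ᵐ a ∂ν, 0 < a.1) {t : ℝ} (ht : 0 < t) (hνt : ∀ᵐ a ∂ν, a.1 ≠ t)
    {f : (Fin (n + 1) → EReal) → ℝ≥0∞} (hfm : Measurable f) (hf : Increasing f) :
    meanSum ν s t f = ∫⁻ a, (if t < a.1 then 0 else
      a.2 * genFun ν s (t - a.1) ^ (a.2 - 1) * meanSum ν s (t - a.1) f +
      a.2 * (a.2 - 1 : ℕ) * genFun ν s (t - a.1) ^ (a.2 - 2) *
        (meanSum ν s (t - a.1) (lastTime f (t - a.1)) * meanOne ν s (t - a.1))) ∂ν := by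
  rw [meanSum, lintegral_node (measurable_treeSum_right hfm _)]
  refine lintegral_congr_ae ?_
  filter_upwards [hν, hνt] with a ha hat
  have hpos := ae_forest_lifetime_pos ν hν
  split_ifs with hta
  · rw [lintegral_congr_ae (g := fun _ => 0), lintegral_zero]
    filter_upwards [hpos] with h hh
    rw [treeSum, Tree.alive_node_of_lt hh ht.le hta, sampleSum_singleton_succ]
  · have hat : a.1 < t := lt_of_le_of_ne (not_lt.1 hta) hat
    have hl : Measurable (lastTime f (t - a.1)) :=
      (measurable_lastTime hfm).comp (measurable_const.prodMk measurable_id)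
    have hA : Measurable (treeSum s (t - a.1) f) :=
      measurable_treeSum_right hfm _
    have hW : Measurable fun T : Tree => weight s (T.alive (t - a.1)) :=
      measurable_weight_alive measurable_id measurable_const
    rw [meanSum, meanSum, meanOne, meanSum, genFun, ← lintegral_forest_same ν a.2 hA hW,
      ← lintegral_forest_split ν a.2
      (measurable_treeSum_right hl _)
      (measurable_treeSum_right measurable_const _) hW,
      ← lintegral_add_left]
    · refine lintegral_congr_ae ?_
      filter_upwards [hpos] with h hh
      exact treeSum_node_succ ha hat hh hf
    · refine Finset.measurable_fun_sum _ fun j _ => Finset.measurable_fun_prod _ fun i _ => ?_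
      split_ifs
      · exact hA.comp (measurable_pi_apply j)
      · exact hW.comp (measurable_pi_apply i)

end

/-! ### Exponential lifetimes and the Volterra equations -/

/-- The law of the mark of an individual. -/
noncomputable def nodeLaw (μ : Measure ℕ) : Measure (ℝ × ℕ) :=
  (expMeasure (μ.real Set.univ)).prod ((μ Set.univ)⁻¹ • μ)

/-- The probability that an individual lives longer than `r`. -/
noncomputable def survival (μ : Measure ℕ) (r : ℝ) : ℝ≥0∞ :=
  ENNReal.ofReal (Real.exp (-(μ.real Set.univ * r)))

lemma measurable_survival {μ : Measure ℕ} : Measurable (survival μ) := by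
  unfold survival; fun_prop

lemma expMeasure_absolutelyContinuous (r : ℝ) : expMeasure r ≪ volume :=
  withDensity_absolutelyContinuous _ _

lemma expMeasure_Ioi {r : ℝ} (hr : 0 < r) {t : ℝ} (ht : 0 ≤ t) :
    expMeasure r (Set.Ioi t) = ENNReal.ofReal (Real.exp (-(r * t))) := by
  have := isProbabilityMeasure_expMeasure hr
  rw [← Set.compl_Iic, prob_compl_eq_one_sub measurableSet_Iic, ← ofReal_cdf,
    cdf_expMeasure_eq hr, if_pos ht, ← ENNReal.ofReal_one,
    ← ENNReal.ofReal_sub _ (sub_nonneg.2 (Real.exp_le_one_iff.2 (by nlinarith)))]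
  congr 1
  ring

lemma ae_fst_ne {μ : Measure ℕ} (t : ℝ) : ∀ᵐ a ∂nodeLaw μ, a.1 ≠ t := by
  have h : ∀ᵐ d ∂expMeasure (μ.real Set.univ), d ≠ t :=
    (expMeasure_absolutelyContinuous _).ae_le (Measure.ae_ne volume t)
  exact Measure.quasiMeasurePreserving_fst.ae h

lemma rate_pos (μ : Measure ℕ) [IsFiniteMeasure μ] [NeZero μ] : 0 < μ.real Set.univ :=
  measureReal_univ_pos

section

variable {μ : Measure ℕ} [IsFiniteMeasure μ] [NeZero μ]

instance (μ : Measure ℕ) [IsFiniteMeasure μ] [NeZero μ] :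
    IsProbabilityMeasure (expMeasure (μ.real Set.univ)) :=
  isProbabilityMeasure_expMeasure (rate_pos μ)

instance (μ : Measure ℕ) [IsFiniteMeasure μ] [NeZero μ] :
    IsProbabilityMeasure ((μ Set.univ)⁻¹ • μ) where
  measure_univ := by
    rw [Measure.smul_apply, smul_eq_mul, ENNReal.inv_mul_cancel]
    · simpa using NeZero.ne μ
    · exact measure_ne_top _ _

instance (μ : Measure ℕ) [IsFiniteMeasure μ] [NeZero μ] : IsProbabilityMeasure (nodeLaw μ) := by
  unfold nodeLaw; infer_instance

lemma ae_fst_pos : ∀ᵐ a ∂nodeLaw μ, 0 < a.1 := by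
  have h : ∀ᵐ d ∂expMeasure (μ.real Set.univ), 0 < d := by
    have := prob_compl_eq_zero_iff (μ := expMeasure (μ.real Set.univ))
      (measurableSet_Ioi (a := (0 : ℝ)))
    rw [ae_iff]
    exact this.2 (by rw [expMeasure_Ioi (rate_pos μ) le_rfl]; simp)
  exact Measure.quasiMeasurePreserving_fst.ae h

/-- Decomposition of an expectation according to the time and the size of the first branching. -/
lemma lintegral_nodeLaw {t : ℝ} (ht : 0 ≤ t) (c : ℝ≥0∞) {G : ℝ → ℕ → ℝ≥0∞}
    (hG : ∀ k, Measurable fun r => G r k) :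
    ∫⁻ a, (if t < a.1 then c else G (t - a.1) a.2) ∂nodeLaw μ =
      c * survival μ t +
        ∫⁻ r in Set.Ioc 0 t, survival μ (t - r) * ∑' k, G r k * μ {k} := by
  have hl := rate_pos μ
  have hG' : Measurable fun z : ℝ × ℕ => G z.1 z.2 := measurable_from_prod_countable_left hG
  have hGs : Measurable fun r => ∑' k, G r k * μ {k} :=
    .tsum fun k => (hG k).mul_const _
  have hmeas : Measurable fun a : ℝ × ℕ => if t < a.1 then c else G (t - a.1) a.2 := by
    refine Measurable.ite (measurableSet_lt measurable_const measurable_fst) measurable_const ?_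
    exact hG'.comp (by fun_prop : Measurable fun a : ℝ × ℕ => (t - a.1, a.2))
  rw [nodeLaw, lintegral_prod _ hmeas.aemeasurable]
  have hinner : ∀ d : ℝ, ∫⁻ k, (if t < d then c else G (t - d) k) ∂((μ Set.univ)⁻¹ • μ) =
      if t < d then c else (μ Set.univ)⁻¹ * ∑' k, G (t - d) k * μ {k} := by
    intro d
    split_ifs
    · rw [lintegral_const, measure_univ, mul_one]
    · rw [lintegral_smul_measure, lintegral_countable', smul_eq_mul]
  simp only [hinner]
  rw [← lintegral_add_compl _ (measurableSet_Ioi (a := t)), Set.compl_Ioi]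
  congr 1
  · rw [setLIntegral_congr_fun measurableSet_Ioi (g := fun _ => c)
      fun d (hd : t < d) => if_pos hd,
      setLIntegral_const, expMeasure_Ioi hl ht, survival]
  -- Substituting r = t - d turns the lifetime into the time left after the first death. The rate in
  -- the exponential density cancels the normalisation of `μ`.
  · rw [setLIntegral_congr_fun measurableSet_Iic
      (g := fun d => (μ Set.univ)⁻¹ * ∑' k, G (t - d) k * μ {k}) 
      fun d (hd : d ≤ t) => if_neg (not_lt.2 hd),
      expMeasure, gammaMeasure, setLIntegral_withDensity_eq_setLIntegral_mul _ _ _ measurableSet_Iic,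
      setLIntegral_congr Iio_ae_eq_Iic.symm, ← lintegral_indicator measurableSet_Iio,
      ← lintegral_indicator measurableSet_Ioc,
      ← lintegral_sub_left_eq_self
        ((Set.Ioc 0 t).indicator fun r => survival μ (t - r) * ∑' k, G r k * μ {k}) t]
    · refine lintegral_congr fun d => ?_
      have hpdf : gammaPDF 1 (μ.real Set.univ) d = exponentialPDF (μ.real Set.univ) d := rfl
      by_cases hdt : d < t
      · by_cases hd0 : 0 ≤ d
        · rw [Set.indicator_of_mem (show d ∈ Set.Iio t from hdt),
            Set.indicator_of_mem (show t - d ∈ Set.Ioc 0 t from ⟨by linarith, by linarith⟩),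
            Pi.mul_apply, hpdf, exponentialPDF_of_nonneg hd0, ENNReal.ofReal_mul hl.le, ← mul_assoc,
            survival, sub_sub_cancel]
          congr 1
          rw [mul_comm, ← mul_assoc, measureReal_def, ENNReal.ofReal_toReal (measure_ne_top _ _),
            ENNReal.inv_mul_cancel, one_mul]
          · simpa using NeZero.ne μ
          · exact measure_ne_top _ _
        · rw [Set.indicator_of_mem (show d ∈ Set.Iio t from hdt), Set.indicator_of_notMem,
            Pi.mul_apply, hpdf, exponentialPDF_of_neg (not_le.1 hd0), zero_mul]
          exact fun h => hd0 (by linarith [h.2])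
      · rw [Set.indicator_of_notMem (show d ∉ Set.Iio t from hdt), Set.indicator_of_notMem]
        exact fun h => hdt (by linarith [h.1])
    · exact (measurable_gammaPDFReal 1 _).ennreal_ofReal
    · exact (hGs.comp (measurable_const.sub measurable_id)).const_mul _

/-- The derivative of the generating function of `μ` along the generating function of the process. -/
noncomputable def rateOne (μ : Measure ℕ) (s : ℝ≥0∞) (r : ℝ) : ℝ≥0∞ :=
  ∑' k : ℕ, k * genFun (nodeLaw μ) s r ^ (k - 1) * μ {k}

/-- The second derivative of the generating function of `μ` along the generating function of the
process. -/
noncomputable def rateTwo (μ : Measure ℕ) (s : ℝ≥0∞) (r : ℝ) : ℝ≥0∞ :=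
  ∑' k : ℕ, k * (k - 1 : ℕ) * genFun (nodeLaw μ) s r ^ (k - 2) * μ {k}

variable {s : ℝ≥0∞} {n : ℕ}

lemma measurable_rateOne : Measurable (rateOne μ s) :=
  .tsum fun _ => ((measurable_genFun.pow_const _).const_mul _).mul_const _

lemma measurable_rateTwo : Measurable (rateTwo μ s) :=
  .tsum fun _ => ((measurable_genFun.pow_const _).const_mul _).mul_const _

/-- This is the variational equation of the generating function in `s`, obtained here from the tree
without differentiating. -/
lemma meanOne_eq {t : ℝ} (ht : 0 < t) :
    meanOne (nodeLaw μ) s t = survival μ t +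
      ∫⁻ r in Set.Ioc 0 t, survival μ (t - r) * (rateOne μ s r * meanOne (nodeLaw μ) s r) := by
  rw [meanOne, meanSum_zero_eq ae_fst_pos ht (ae_fst_ne t), lintegral_nodeLaw ht.le 1
    (G := fun r k => k * genFun (nodeLaw μ) s r ^ (k - 1) * meanSum (n := 0) (nodeLaw μ) s r fun _ => 1)]
  · rw [one_mul]
    congr 1
    refine lintegral_congr fun r => ?_
    rw [rateOne, ← ENNReal.tsum_mul_right]
    congr 1
    exact tsum_congr fun k => by rw [meanOne]; ring
  · exact fun k => ((measurable_genFun.pow_const _).const_mul _).mul measurable_meanOne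

/-- The linear kernel is that of `meanOne_eq`, with the split at the root as source term. This
common kernel makes variation of constants available. -/
lemma meanSum_eq {t : ℝ} (ht : 0 < t) {f : (Fin (n + 1) → EReal) → ℝ≥0∞} (hfm : Measurable f)
    (hf : Increasing f) :
    meanSum (nodeLaw μ) s t f = ∫⁻ r in Set.Ioc 0 t, survival μ (t - r) *
      (rateOne μ s r * meanSum (nodeLaw μ) s r f +
        rateTwo μ s r * (meanSum (nodeLaw μ) s r (lastTime f r) * meanOne (nodeLaw μ) s r)) := by
  have h1 := measurable_meanSum (ν := nodeLaw μ) (s := s) (f := fun _ => f) (hfm.comp measurable_snd)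
  have h2 := measurable_meanSum (ν := nodeLaw μ) (s := s) (measurable_lastTime hfm)
  rw [meanSum_succ_eq ae_fst_pos ht (ae_fst_ne t) hfm hf, lintegral_nodeLaw ht.le 0
    (G := fun r k => k * genFun (nodeLaw μ) s r ^ (k - 1) * meanSum (nodeLaw μ) s r f +
      k * (k - 1 : ℕ) * genFun (nodeLaw μ) s r ^ (k - 2) *
        (meanSum (nodeLaw μ) s r (lastTime f r) * meanOne (nodeLaw μ) s r))]
  · rw [zero_mul, zero_add]
    refine lintegral_congr fun r => ?_
    rw [rateOne, rateTwo, ← ENNReal.tsum_mul_right, ← ENNReal.tsum_mul_right, ← ENNReal.tsum_add]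
    congr 1
    exact tsum_congr fun k => by ring
  · exact fun k => (((measurable_genFun.pow_const _).const_mul _).mul h1).add
      (((measurable_genFun.pow_const _).const_mul _).mul (h2.mul measurable_meanOne))

end

/-! ### Bounds that follow from s < 1 -/

section Bounds

variable {s : ℝ≥0∞}

lemma exists_pow_mul_pow_sub_le (hs : s < 1) (m : ℕ) :
    ∃ C : ℝ≥0∞, C ≠ ⊤ ∧ ∀ z : ℕ, (z : ℝ≥0∞) ^ m * s ^ (z - m) ≤ C := by
  -- Unlike `s`, the intermediate `q` is certainly positive, so division by `q ^ m` is allowed.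
  obtain ⟨q, hsq, hq1⟩ := ENNReal.lt_iff_exists_nnreal_btwn.1 hs
  have hq1 : q < 1 := by exact_mod_cast hq1
  have hq0 : 0 < q := by
    have := zero_le.trans_lt hsq
    exact_mod_cast this
  have hlim := tendsto_pow_const_mul_const_pow_of_lt_one m q.2 (by exact_mod_cast hq1 : (q : ℝ) < 1)
  obtain ⟨c, hc⟩ := hlim.bddAbove_range
  -- The summand `m ^ m` handles `z ≤ m`, where the truncated exponent is 0.
  refine ⟨ENNReal.ofReal (c / q ^ m) + (m : ℝ≥0∞) ^ m, by finiteness, fun z => ?_⟩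
  rcases le_total z m with h | h
  · rw [Nat.sub_eq_zero_of_le h, pow_zero, mul_one]
    refine le_add_left ?_
    gcongr
  · refine le_add_right ?_
    calc (z : ℝ≥0∞) ^ m * s ^ (z - m) ≤ (z : ℝ≥0∞) ^ m * (q : ℝ≥0∞) ^ (z - m) := by gcongr
      _ = ENNReal.ofReal ((z : ℝ) ^ m * (q : ℝ) ^ (z - m)) := by
        rw [ENNReal.ofReal_mul (by positivity), ENNReal.ofReal_pow (by positivity),
          ENNReal.ofReal_pow (by positivity), ENNReal.ofReal_natCast, ENNReal.ofReal_coe_nnreal]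
      _ ≤ ENNReal.ofReal (c / q ^ m) := by
        refine ENNReal.ofReal_le_ofReal ?_
        rw [le_div_iff₀ (by positivity), mul_assoc, ← pow_add, Nat.sub_add_cancel h]
        exact hc ⟨z, rfl⟩

lemma weight_diff_range {β : Type*} {m : ℕ} {S : Set β} (hS : S.Finite) {v : Fin m → β}
    (hv : Function.Injective v) (hvS : ∀ k, v k ∈ S) :
    weight s (S \ Set.range v) = s ^ (S.ncard - m) := by
  classical
  rw [weight, if_pos hS.sdiff, Set.ncard_sdiff (by rintro _ ⟨k, rfl⟩; exact hvS k)
    (Set.finite_range v), ← Set.image_univ, Set.ncard_image_of_injective _ hv, Set.ncard_univ,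
    Nat.card_fin]

lemma weight_diff_range_of_infinite {β : Type*} {m : ℕ} {S : Set β} (hS : ¬ S.Finite)
    (v : Fin m → β) : weight s (S \ Set.range v) = 0 := by
  classical
  rw [weight, if_neg]
  exact fun h => hS (h.of_sdiff (Set.finite_range v))

/-- There are at most `S.ncard ^ m` samples and each leaves `S.ncard - m` individuals. For infinite
`S` every weight is 0. -/
lemma sampleSum_le {m : ℕ} {β : Type*} {S : Set β} {C : (Fin m → β) → ℝ≥0∞} (hC : ∀ v, C v ≤ 1) :
    sampleSum s S C ≤ (S.ncard : ℝ≥0∞) ^ m * s ^ (S.ncard - m) := by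
  classical
  unfold sampleSum
  by_cases hS : S.Finite
  · calc
      _ ≤ ∑' v : Fin m → β, if v ∈ Fintype.piFinset fun _ => hS.toFinset then
          s ^ (S.ncard - m) else 0 := by
        refine ENNReal.tsum_le_tsum fun v => ?_
        split_ifs with h1 h2 h2
        · rw [weight_diff_range hS h1.1 h1.2]
          exact mul_le_of_le_one_left' (hC v)
        · exact absurd (Fintype.mem_piFinset.2 fun k => by simpa using h1.2 k) h2
        · exact zero_le
        · exact le_rfl
      _ = _ := by
        rw [tsum_eq_sum (s := Fintype.piFinset fun _ => hS.toFinset) fun v hv => if_neg hv,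
          Finset.sum_congr rfl fun v hv => if_pos hv, Finset.sum_const, nsmul_eq_mul,
          Fintype.card_piFinset, Finset.prod_const, Set.ncard_eq_toFinset_card _ hS]
        simp
  · refine le_of_eq_of_le ?_ zero_le
    rw [ENNReal.tsum_eq_zero]
    intro v
    rw [weight_diff_range_of_infinite hS, mul_zero, ite_self]

/-- The bound is uniform in `t` and `f`: this is the a priori estimate required by Grönwall's
argument. -/
lemma exists_meanSum_le (hs : s < 1) (n : ℕ) (ν : Measure (ℝ × ℕ)) [IsProbabilityMeasure ν] :
    ∃ C : ℝ≥0∞, C ≠ ⊤ ∧ ∀ (t : ℝ) (f : (Fin n → EReal) → ℝ≥0∞), (∀ τ, f τ ≤ 1) →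
      meanSum ν s t f ≤ C := by
  obtain ⟨C, hC, h⟩ := exists_pow_mul_pow_sub_le hs (n + 1)
  refine ⟨C, hC, fun t f hf => ?_⟩
  calc meanSum ν s t f ≤ ∫⁻ _, C ∂treeLaw ν :=
        lintegral_mono fun T => (sampleSum_le fun v => hf _).trans (h _)
    _ = C := by rw [lintegral_const, measure_univ, mul_one]

variable {μ : Measure ℕ} [IsFiniteMeasure μ] [NeZero μ]

lemma nodeLaw_lifetime_gt {t : ℝ} (ht : 0 ≤ t) : nodeLaw μ {a | t < a.1} = survival μ t := by
  have : {a : ℝ × ℕ | t < a.1} = Set.Ioi t ×ˢ Set.univ := by ext; simp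
  rw [this, nodeLaw, Measure.prod_prod, measure_univ, mul_one, expMeasure_Ioi (rate_pos μ) ht,
    survival]

/-- With probability `survival μ T` the founder outlives `T` and is alone up to then, contributing
`s`; elsewhere the weight is at most 1. Hence the bound s p + (1 - p) < 1. -/
lemma exists_genFun_le (hs : s < 1) {T : ℝ} (hT : 0 ≤ T) :
    ∃ q < 1, ∀ r, 0 ≤ r → r ≤ T → genFun (nodeLaw μ) s r ≤ q := by
  have hm : MeasurableSet {a : ℝ × ℕ | T < a.1} := measurableSet_lt measurable_const measurable_fst
  set p := survival μ T with hp
  have hp0 : p ≠ 0 := by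
    rw [hp, survival, Ne, ENNReal.ofReal_eq_zero, not_le]
    exact Real.exp_pos _
  have hpt : p ≠ ⊤ := ENNReal.ofReal_ne_top
  have hsum : p + nodeLaw μ {a | T < a.1}ᶜ = 1 := by
    rw [hp, ← nodeLaw_lifetime_gt hT, measure_add_measure_compl hm, measure_univ]
  refine ⟨s * p + nodeLaw μ {a | T < a.1}ᶜ, ?_, fun r hr0 hrT => ?_⟩
  · rw [← hsum]
    refine ENNReal.add_lt_add_right (measure_ne_top _ _) ?_
    calc s * p < 1 * p := ENNReal.mul_lt_mul_left hp0 hpt hs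
      _ = p := one_mul p
  · rw [genFun, lintegral_node (measurable_weight_alive_right r),
      ← lintegral_add_compl _ hm]
    refine add_le_add ?_ ?_
    · rw [hp, ← nodeLaw_lifetime_gt hT, ← setLIntegral_const]
      refine setLIntegral_mono' hm fun a ha => ?_
      calc ∫⁻ h, weight s ((Tree.node a h).alive r) ∂forestLaw (nodeLaw μ)
          = ∫⁻ _, s ∂forestLaw (nodeLaw μ) := by
            refine lintegral_congr_ae ?_
            filter_upwards [ae_forest_lifetime_pos (nodeLaw μ) ae_fst_pos] with h hh
            rw [Tree.alive_node_of_lt hh hr0 (hrT.trans_lt ha)]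
            simp [weight]
        _ ≤ s := by rw [lintegral_const, measure_univ, mul_one]
    · calc _ ≤ ∫⁻ _ in {a : ℝ × ℕ | T < a.1}ᶜ, 1 ∂nodeLaw μ := by
            refine lintegral_mono fun a => ?_
            calc _ ≤ ∫⁻ _, 1 ∂forestLaw (nodeLaw μ) :=
                  lintegral_mono fun h => weight_le_one hs.le _
              _ ≤ 1 := by rw [lintegral_const, measure_univ, mul_one]
        _ = _ := by rw [setLIntegral_const, one_mul]

lemma tsum_measure_singleton (μ : Measure ℕ) : ∑' k, μ {k} = μ Set.univ := by
  have := lintegral_countable' (μ := μ) (fun _ => 1)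
  simpa using this.symm

/-- The generating function stays below some `q < 1`, so k q^(k-1) and k² q^(k-2) are bounded in k.
The finite mass of `μ` then suffices, even when it has no moments. -/
lemma exists_rate_le (hs : s < 1) {T : ℝ} (hT : 0 ≤ T) :
    ∃ C : ℝ≥0∞, C ≠ ⊤ ∧ ∀ r, 0 ≤ r → r ≤ T → rateOne μ s r ≤ C ∧ rateTwo μ s r ≤ C := by
  obtain ⟨q, hq, h⟩ := exists_genFun_le (μ := μ) hs hT
  obtain ⟨C₁, hC₁, h₁⟩ := exists_pow_mul_pow_sub_le hq 1
  obtain ⟨C₂, hC₂, h₂⟩ := exists_pow_mul_pow_sub_le hq 2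
  have hfin := measure_ne_top μ Set.univ
  refine ⟨C₁ * μ Set.univ + C₂ * μ Set.univ, by finiteness, fun r h0 hr => ⟨?_, ?_⟩⟩
  · refine le_add_right ?_
    rw [rateOne, ← tsum_measure_singleton μ, ← ENNReal.tsum_mul_left]
    refine ENNReal.tsum_le_tsum fun k => ?_
    gcongr
    refine le_trans ?_ (h₁ k)
    rw [pow_one]
    gcongr
    exact h r h0 hr
  · refine le_add_left ?_
    rw [rateTwo, ← tsum_measure_singleton μ, ← ENNReal.tsum_mul_left]
    refine ENNReal.tsum_le_tsum fun k => ?_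
    gcongr
    refine le_trans ?_ (h₂ k)
    rw [pow_two]
    gcongr
    · omega
    · exact h r h0 hr

end Bounds

/-! ### Volterra equations and the joint density -/

/-- Grönwall's comparison of a bounded subsolution with a supersolution of a linear Volterra
equation. -/
lemma le_of_volterra {T : ℝ} {a b : ℝ → ℝ≥0∞} {K g : ℝ → ℝ → ℝ≥0∞} {C B : ℝ≥0∞} (hC : C ≠ ⊤)
    (hB : B ≠ ⊤) (hK : ∀ t r, 0 < r → r ≤ t → t ≤ T → K t r ≤ C)
    (haB : ∀ t, 0 < t → t ≤ T → a t ≤ B)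
    (ha : ∀ t, 0 < t → t ≤ T → a t ≤ ∫⁻ r in Set.Ioc 0 t, K t r * a r + g t r)
    (hb : ∀ t, 0 < t → t ≤ T → ∫⁻ r in Set.Ioc 0 t, K t r * b r + g t r ≤ b t)
    {t : ℝ} (ht : 0 < t) (htT : t ≤ T) : a t ≤ b t := by
  set c : ℝ := C.toReal + 1 with hc
  have hc0 : 0 < c := by positivity
  have hCc : C ≤ ENNReal.ofReal c := by
    rw [← ENNReal.ofReal_toReal hC]
    exact ENNReal.ofReal_le_ofReal (by simp [hc])
  let e : ℝ → ℝ≥0∞ := fun r => ENNReal.ofReal (Real.exp (2 * c * r))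
  have he : Measurable e := by fun_prop
  -- The exponent 2c is chosen so that one application of the kernel bound c to `e` gains a factor
  -- 1/2.
  have hint : ∀ t : ℝ, 0 < t → ∫⁻ r in Set.Ioc 0 t, ENNReal.ofReal c * e r ≤ e t * 2⁻¹ := by
    intro t ht
    have hderiv : ∀ r ∈ Set.uIcc 0 t, HasDerivAt (fun r => Real.exp (2 * c * r) / 2)
        (c * Real.exp (2 * c * r)) r := by
      intro r _
      convert! ((((hasDerivAt_id r).const_mul (2 * c)).exp).div_const 2) using 1
      simp; ring
    have hcont : Continuous fun r : ℝ => c * Real.exp (2 * c * r) := by fun_prop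
    have h1 := intervalIntegral.integral_eq_sub_of_hasDerivAt hderiv
      (hcont.intervalIntegrable 0 t)
    rw [intervalIntegral.integral_of_le ht.le] at h1
    have h2 : ∫⁻ r in Set.Ioc 0 t, ENNReal.ofReal c * e r =
        ∫⁻ r in Set.Ioc 0 t, ENNReal.ofReal (c * Real.exp (2 * c * r)) :=
      lintegral_congr fun r => (ENNReal.ofReal_mul hc0.le).symm
    rw [h2, ← ofReal_integral_eq_lintegral_ofReal, h1]
    · rw [show (2⁻¹ : ℝ≥0∞) = ENNReal.ofReal 2⁻¹ by
        rw [ENNReal.ofReal_inv_of_pos two_pos]; simp]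
      rw [← ENNReal.ofReal_mul (Real.exp_pos _).le]
      refine ENNReal.ofReal_le_ofReal ?_
      have := Real.exp_pos (2 * c * 0)
      linarith
    · exact (hcont.integrableOn_Icc).mono_set Set.Ioc_subset_Icc_self
    · exact ae_of_all _ fun r => by positivity
  -- Iterating the inequality halves the error term each time, starting from the a priori bound `B`.
  have hstep : ∀ m : ℕ, ∀ t, 0 < t → t ≤ T → a t ≤ b t + B * 2⁻¹ ^ m * e t := by
    intro m
    induction m with
    | zero =>
      intro t ht htT
      refine (haB t ht htT).trans (le_add_left ?_)
      rw [pow_zero, mul_one]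
      refine le_mul_of_one_le_right' ?_
      exact ENNReal.one_le_ofReal.2 (Real.one_le_exp (by positivity))
    | succ m ih =>
      intro t ht htT
      calc a t ≤ ∫⁻ r in Set.Ioc 0 t, K t r * a r + g t r := ha t ht htT
        _ ≤ ∫⁻ r in Set.Ioc 0 t, (K t r * b r + g t r) +
              B * 2⁻¹ ^ m * (ENNReal.ofReal c * e r) := by
          refine setLIntegral_mono' measurableSet_Ioc fun r hr => ?_
          calc K t r * a r + g t r
              ≤ K t r * (b r + B * 2⁻¹ ^ m * e r) + g t r := by
                gcongr
                exact ih r hr.1 (hr.2.trans htT)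
            _ = (K t r * b r + g t r) + B * 2⁻¹ ^ m * (K t r * e r) := by ring
            _ ≤ _ := by
                gcongr
                exact (hK t r hr.1 hr.2 htT).trans hCc
        _ = (∫⁻ r in Set.Ioc 0 t, (K t r * b r + g t r)) +
              B * 2⁻¹ ^ m * ∫⁻ r in Set.Ioc 0 t, ENNReal.ofReal c * e r := by
          rw [lintegral_add_right _ (by fun_prop), lintegral_const_mul _ (by fun_prop)]
        _ ≤ b t + B * 2⁻¹ ^ m * (e t * 2⁻¹) := by
          gcongr
          · exact hb t ht htT
          · exact hint t ht
        _ = b t + B * 2⁻¹ ^ (m + 1) * e t := by ring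
  have hlim : Filter.Tendsto (fun m : ℕ => b t + B * 2⁻¹ ^ m * e t) Filter.atTop
      (nhds (b t + B * 0 * e t)) := by
    refine tendsto_const_nhds.add (ENNReal.Tendsto.mul_const (ENNReal.Tendsto.const_mul
      (ENNReal.tendsto_pow_atTop_nhds_zero_of_lt_one ?_) (.inr hB)) (.inr ENNReal.ofReal_ne_top))
    exact ENNReal.inv_lt_one.2 ENNReal.one_lt_two
  rw [mul_zero, zero_mul, add_zero] at hlim
  exact ge_of_tendsto' hlim fun m => hstep m t ht htT

section

variable {μ : Measure ℕ} [IsFiniteMeasure μ] [NeZero μ] {s : ℝ≥0∞} {n : ℕ}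

lemma survival_mul (μ : Measure ℕ) (a b : ℝ) :
    survival μ a * survival μ b = survival μ (a + b) := by
  rw [survival, survival, survival, ← ENNReal.ofReal_mul (Real.exp_pos _).le, ← Real.exp_add]
  congr 2
  ring

/-- The flow property of the linear equation satisfied by `meanOne`. -/
lemma meanOne_eq_from {u t : ℝ} (hu : 0 < u) (hut : u ≤ t) :
    meanOne (nodeLaw μ) s t = survival μ (t - u) * meanOne (nodeLaw μ) s u +
      ∫⁻ r in Set.Ioc u t, survival μ (t - r) * (rateOne μ s r * meanOne (nodeLaw μ) s r) := by
  have hm : Measurable fun r => survival μ (u - r) * (rateOne μ s r * meanOne (nodeLaw μ) s r) :=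
    (measurable_survival.comp (by fun_prop)).mul (measurable_rateOne.mul measurable_meanOne)
  have hcongr : ∀ r, survival μ (t - u) * (survival μ (u - r) *
      (rateOne μ s r * meanOne (nodeLaw μ) s r)) =
      survival μ (t - r) * (rateOne μ s r * meanOne (nodeLaw μ) s r) := by
    intro r
    rw [← mul_assoc, survival_mul, sub_add_sub_cancel]
  rw [meanOne_eq (hu.trans_le hut), meanOne_eq hu, mul_add, survival_mul, sub_add_cancel,
    ← lintegral_const_mul _ hm, ← Set.Ioc_union_Ioc_eq_Ioc hu.le hut,
    lintegral_union measurableSet_Ioc, add_assoc]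
  · simp only [hcongr]
  · rw [Set.disjoint_left]
    intro r h1 h2
    exact absurd h2.1 (not_lt.2 h1.2)

/-- Variation of constants. -/
lemma meanOne_mul_lintegral {Q : ℝ → ℝ≥0∞} (hQ : Measurable Q) {t : ℝ} :
    meanOne (nodeLaw μ) s t * ∫⁻ u in Set.Ioc 0 t, Q u =
      ∫⁻ r in Set.Ioc 0 t, survival μ (t - r) *
        (rateOne μ s r * (meanOne (nodeLaw μ) s r * ∫⁻ u in Set.Ioc 0 r, Q u) +
          Q r * meanOne (nodeLaw μ) s r) := by
  have hS : Measurable fun r => survival μ (t - r) := measurable_survival.comp (by fun_prop)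
  have hA : Measurable fun r => survival μ (t - r) *
      (rateOne μ s r * meanOne (nodeLaw μ) s r) :=
    hS.mul (measurable_rateOne.mul measurable_meanOne)
  set A := fun r => survival μ (t - r) * (rateOne μ s r * meanOne (nodeLaw μ) s r) with hAdef
  have hB : Measurable fun u => Q u * (survival μ (t - u) * meanOne (nodeLaw μ) s u) :=
    hQ.mul (hS.mul measurable_meanOne)
  -- Tonelli on the triangle 0 < u ≤ r ≤ t.
  have hswap : ∫⁻ r in Set.Ioc 0 t, A r * ∫⁻ u in Set.Ioc 0 r, Q u =
      ∫⁻ u in Set.Ioc 0 t, Q u * ∫⁻ r in Set.Ioc u t, A r := by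
    let J : ℝ → ℝ → ℝ≥0∞ := fun r u =>
      {z : ℝ × ℝ | 0 < z.2 ∧ z.2 ≤ z.1 ∧ z.1 ≤ t}.indicator (fun z => A z.1 * Q z.2) (r, u)
    have hJset : MeasurableSet {z : ℝ × ℝ | 0 < z.2 ∧ z.2 ≤ z.1 ∧ z.1 ≤ t} :=
      (measurableSet_lt measurable_const measurable_snd).inter
        ((measurableSet_le measurable_snd measurable_fst).inter
          (measurableSet_le measurable_fst measurable_const))
    have hJ : Measurable (Function.uncurry J) :=
      ((hA.comp measurable_fst).mul (hQ.comp measurable_snd)).indicator hJset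
    have h1 : ∫⁻ r in Set.Ioc 0 t, A r * ∫⁻ u in Set.Ioc 0 r, Q u = ∫⁻ r, ∫⁻ u, J r u := by
      rw [← lintegral_indicator measurableSet_Ioc]
      refine lintegral_congr fun r => ?_
      by_cases hr : r ∈ Set.Ioc 0 t
      · rw [Set.indicator_of_mem hr, ← lintegral_const_mul _ hQ,
          ← lintegral_indicator measurableSet_Ioc]
        refine lintegral_congr fun u => ?_
        simp only [J, Set.indicator, Set.mem_Ioc, Set.mem_ofPred_eq, hr.2, and_true]
      · rw [Set.indicator_of_notMem hr, eq_comm]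
        refine (lintegral_congr fun u => ?_).trans lintegral_zero
        exact Set.indicator_of_notMem (fun h => hr ⟨h.1.trans_le h.2.1, h.2.2⟩) _
    have h2 : ∫⁻ u in Set.Ioc 0 t, Q u * ∫⁻ r in Set.Ioc u t, A r = ∫⁻ u, ∫⁻ r, J r u := by
      rw [← lintegral_indicator measurableSet_Ioc]
      refine lintegral_congr fun u => ?_
      by_cases hu : u ∈ Set.Ioc 0 t
      · rw [Set.indicator_of_mem hu, setLIntegral_congr Ioc_ae_eq_Icc, ← lintegral_const_mul _ hA,
          ← lintegral_indicator measurableSet_Icc]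
        refine lintegral_congr fun r => ?_
        simp only [J, Set.indicator, Set.mem_Icc, Set.mem_ofPred_eq, hu.1, true_and]
        rw [mul_comm]
      · rw [Set.indicator_of_notMem hu, eq_comm]
        refine (lintegral_congr fun r => ?_).trans lintegral_zero
        exact Set.indicator_of_notMem (fun h => hu ⟨h.1, h.2.1.trans h.2.2⟩) _
    rw [h1, h2, lintegral_lintegral_swap hJ.aemeasurable]
  -- For each `u`, `meanOne` at `t` is expanded from time `u` by the flow property. The boundary
  -- terms give the source and, after the swap, the integrals give the linear term.
  calc meanOne (nodeLaw μ) s t * ∫⁻ u in Set.Ioc 0 t, Q u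
      = ∫⁻ u in Set.Ioc 0 t, (Q u * (survival μ (t - u) * meanOne (nodeLaw μ) s u) +
          Q u * ∫⁻ r in Set.Ioc u t, A r) := by
        rw [← lintegral_const_mul _ hQ]
        refine setLIntegral_congr_fun measurableSet_Ioc fun u hu => ?_
        rw [meanOne_eq_from hu.1 hu.2]
        ring
    _ = ∫⁻ r in Set.Ioc 0 t, (Q r * (survival μ (t - r) * meanOne (nodeLaw μ) s r) +
          A r * ∫⁻ u in Set.Ioc 0 r, Q u) := by
        rw [lintegral_add_left hB, lintegral_add_left hB, hswap]
    _ = _ := by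
        refine lintegral_congr fun r => ?_
        simp only [hAdef]
        ring

lemma increasing_lastTime {f : (Fin (n + 1) → EReal) → ℝ≥0∞} (hf : Increasing f) (r : ℝ) :
    Increasing (lastTime f r) := by
  intro τ hτ
  obtain ⟨h1, h2⟩ := hf _ hτ
  constructor
  · intro i j hij
    have := h1 (Fin.castSucc_lt_castSucc_iff.2 hij)
    simpa using this
  · intro i
    simpa using h2 i.castSucc

lemma lastTime_eq_zero {f : (Fin (n + 1) → EReal) → ℝ≥0∞} (hf : Increasing f) {r : ℝ}
    (hr : r ≤ 0) : lastTime f r = 0 := by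
  funext τ
  by_contra h
  have := ((hf _ h).2 (Fin.last n)).1
  rw [Fin.snoc_last] at this
  exact absurd this (by simpa using hr)

lemma measurable_lastTime_right {f : (Fin (n + 1) → EReal) → ℝ≥0∞} (hf : Measurable f) (r : ℝ) :
    Measurable (lastTime f r) :=
  (measurable_lastTime hf).comp (measurable_const.prodMk measurable_id)

/-- The mean sum disintegrated along the last coalescence time. -/
lemma meanSum_succ_eq_lintegral (hs : s < 1) {t : ℝ} (ht : 0 < t)
    {f : (Fin (n + 1) → EReal) → ℝ≥0∞} (hfm : Measurable f) (hf : Increasing f)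
    (hf1 : ∀ τ, f τ ≤ 1) :
    meanSum (nodeLaw μ) s t f = meanOne (nodeLaw μ) s t *
      ∫⁻ u in Set.Ioc 0 t, rateTwo μ s u * meanSum (nodeLaw μ) s u (lastTime f u) := by
  let Q : ℝ → ℝ≥0∞ := fun u => rateTwo μ s u * meanSum (nodeLaw μ) s u (lastTime f u)
  have hQ : Measurable Q := measurable_rateTwo.mul (measurable_meanSum (measurable_lastTime hfm))
  let y : ℝ → ℝ≥0∞ := fun t => meanOne (nodeLaw μ) s t * ∫⁻ u in Set.Ioc 0 t, Q u
  let K : ℝ → ℝ → ℝ≥0∞ := fun t r => survival μ (t - r) * rateOne μ s r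
  let g : ℝ → ℝ → ℝ≥0∞ := fun t r => survival μ (t - r) * (Q r * meanOne (nodeLaw μ) s r)
  obtain ⟨C₁, hC₁, hM⟩ := exists_meanSum_le hs (n + 1) (nodeLaw μ)
  obtain ⟨C₂, hC₂, hN⟩ := exists_meanSum_le hs n (nodeLaw μ)
  obtain ⟨C₃, hC₃, hD⟩ := exists_meanSum_le hs 0 (nodeLaw μ)
  obtain ⟨C₄, hC₄, hR⟩ := exists_rate_le (μ := μ) hs ht.le
  have hK : ∀ t' r, 0 < r → r ≤ t' → t' ≤ t → K t' r ≤ C₄ := by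
    intro t' r h0 hr ht'
    have h1 : survival μ (t' - r) ≤ 1 := by
      rw [survival, ENNReal.ofReal_le_one, Real.exp_le_one_iff]
      have := rate_pos μ
      nlinarith
    calc K t' r ≤ 1 * C₄ := mul_le_mul' h1 (hR r h0.le (hr.trans ht')).1
      _ = C₄ := one_mul _
  have hyB : ∀ t', 0 < t' → t' ≤ t → y t' ≤ C₃ * (C₄ * C₂ * ENNReal.ofReal t) := by
    intro t' h0 ht'
    refine mul_le_mul' (hD t' _ fun _ => le_rfl) ?_
    calc ∫⁻ u in Set.Ioc 0 t', Q u ≤ ∫⁻ u in Set.Ioc 0 t', C₄ * C₂ := by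
          refine setLIntegral_mono' measurableSet_Ioc fun u hu => ?_
          exact mul_le_mul' (hR u hu.1.le (hu.2.trans ht')).2 (hN u _ fun τ => hf1 _)
      _ ≤ C₄ * C₂ * ENNReal.ofReal t := by
          rw [setLIntegral_const, Real.volume_Ioc, sub_zero]
          gcongr
  have hMeq : ∀ t', 0 < t' → t' ≤ t → meanSum (nodeLaw μ) s t' f =
      ∫⁻ r in Set.Ioc 0 t', K t' r * meanSum (nodeLaw μ) s r f + g t' r := by
    intro t' h0 _
    rw [meanSum_eq h0 hfm hf]
    exact lintegral_congr fun r => by simp only [K, g, Q]; ring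
  have hyeq : ∀ t', 0 < t' → t' ≤ t → y t' = ∫⁻ r in Set.Ioc 0 t', K t' r * y r + g t' r := by
    intro t' _ _
    rw [show y t' = _ from meanOne_mul_lintegral hQ]
    exact lintegral_congr fun r => by simp only [K, g, y]; ring
  -- Both sides are bounded solutions of the same equation, so each is compared with the other.
  apply le_antisymm
  · exact le_of_volterra (b := y) hC₄ hC₁ hK (fun t' _ _ => hM t' f hf1)
      (fun t' h h' => (hMeq t' h h').le) (fun t' h h' => (hyeq t' h h').ge) ht le_rfl
  · exact le_of_volterra (a := y) hC₄ (by finiteness) hK hyB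
      (fun t' h h' => (hyeq t' h h').le) (fun t' h h' => (hMeq t' h h').ge) ht le_rfl

lemma meanSum_zero_const {ν : Measure (ℝ × ℕ)} [IsProbabilityMeasure ν] (t : ℝ)
    (f : (Fin 0 → EReal) → ℝ≥0∞) : meanSum ν s t f = meanOne ν s t * f Fin.elim0 := by
  rw [meanOne, meanSum, meanSum, ← lintegral_mul_const _ (measurable_treeSum_right measurable_const t)]
  refine lintegral_congr fun T => ?_
  rw [treeSum, treeSum, sampleSum, sampleSum, ← ENNReal.tsum_mul_right]
  refine tsum_congr fun v => ?_
  rw [Subsingleton.elim (T.coals t v) Fin.elim0]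
  split_ifs
  · ring
  · rw [zero_mul]

lemma lintegral_fin_succ {F : (Fin (n + 1) → ℝ) → ℝ≥0∞} (hF : Measurable F) :
    ∫⁻ τ, F τ = ∫⁻ u, ∫⁻ τ : Fin n → ℝ, F (Fin.snoc (α := fun _ => ℝ) τ u) := by
  have h := (volume_preserving_piFinSuccAbove (fun _ : Fin (n + 1) => ℝ) (Fin.last n)).symm
  rw [← h.lintegral_comp hF, Measure.volume_eq_prod, lintegral_prod]
  · refine lintegral_congr fun u => lintegral_congr fun τ => ?_
    congr 1
    exact Fin.insertNth_last' u τ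
  · exact (hF.comp h.measurable).aemeasurable

open Classical in
lemma measurable_density {f : (Fin n → EReal) → ℝ≥0∞} (hfm : Measurable f) (t : ℝ) :
    Measurable fun τ : Fin n → ℝ => if ∀ i, τ i ≤ t then
      f (fun i => (τ i : EReal)) * ∏ i, (meanOne (nodeLaw μ) s (τ i) * rateTwo μ s (τ i))
      else 0 := by
  refine Measurable.ite ?_ (Measurable.mul ?_ ?_) measurable_const
  · have : {τ : Fin n → ℝ | ∀ i, τ i ≤ t} = ⋂ i, {τ | τ i ≤ t} := by ext; simp
    rw [this]
    exact .iInter fun i => measurableSet_le (by fun_prop) measurable_const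
  · exact hfm.comp (measurable_pi_lambda _ fun i => (measurable_pi_apply i).coe_real_ereal)
  · exact Finset.measurable_fun_prod _ fun i _ =>
      (measurable_meanOne.comp (measurable_pi_apply i)).mul
        (measurable_rateTwo.comp (measurable_pi_apply i))

open Classical in
/-- The joint density of the coalescence times. -/
theorem meanSum_eq_lintegral (hs : s < 1) {t : ℝ} (ht : 0 < t)
    {f : (Fin n → EReal) → ℝ≥0∞} (hfm : Measurable f) (hf : Increasing f)
    (hf1 : ∀ τ, f τ ≤ 1) :
    meanSum (nodeLaw μ) s t f = meanOne (nodeLaw μ) s t * ∫⁻ τ : Fin n → ℝ,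
      if ∀ i, τ i ≤ t then
        f (fun i => (τ i : EReal)) * ∏ i, (meanOne (nodeLaw μ) s (τ i) * rateTwo μ s (τ i))
      else 0 := by
  -- Once the last time `u` is removed, the remaining mean sum is evaluated at `u`, so `t` must
  -- vary.
  induction n generalizing t with
  | zero =>
    rw [meanSum_zero_const, Measure.volume_pi_eq_dirac Fin.elim0, lintegral_dirac, if_pos fun i => i.elim0,
      Finset.univ_eq_empty, Finset.prod_empty, mul_one]
    congr 2
    exact Subsingleton.elim _ _
  | succ n ih =>
    rw [meanSum_succ_eq_lintegral hs ht hfm hf hf1, lintegral_fin_succ (measurable_density hfm t),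
      ← lintegral_indicator measurableSet_Ioc]
    congr 1
    refine lintegral_congr fun u => ?_
    have hcoe : ∀ τ : Fin n → ℝ, (fun i => ((Fin.snoc (α := fun _ => ℝ) τ u i : ℝ) : EReal)) =
        Fin.snoc (α := fun _ => EReal) (fun i => (τ i : EReal)) (u : EReal) := by
      intro τ
      funext i
      refine Fin.lastCases ?_ (fun i => ?_) i <;> simp
    simp only [hcoe, Fin.prod_univ_castSucc, Fin.snoc_castSucc, Fin.snoc_last,
      Fin.forall_fin_succ']
    by_cases hu : u ∈ Set.Ioc 0 t
    · rw [Set.indicator_of_mem hu, ih hu.1 (measurable_lastTime_right hfm u)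
        (increasing_lastTime hf u) (fun τ => hf1 _), ← mul_assoc, 
        ← lintegral_const_mul _ (measurable_density (measurable_lastTime_right hfm u) u)]
      refine lintegral_congr fun τ => ?_
      simp only [hu.2, and_true]
      -- Where `f` does not vanish the times lie below `u`, so the cutoffs at `u` and at `t` both
      -- hold.
      by_cases h0 : lastTime f u (fun i => (τ i : EReal)) = 0
      · have h0' := h0
        rw [lastTime] at h0'
        simp [h0, h0']
      · have hlt : ∀ i, τ i < u := by
          intro i
          have := (hf _ h0).1 (Fin.castSucc_lt_last i)
          simpa using this
        rw [if_pos fun i => (hlt i).le, if_pos fun i => (hlt i).le.trans hu.2, lastTime]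
        ring
    · rw [Set.indicator_of_notMem hu, eq_comm]
      refine (lintegral_congr fun τ => ?_).trans lintegral_zero
      split_ifs with h
      · have h0 : lastTime f u (fun i => (τ i : EReal)) = 0 := by
          rw [lastTime_eq_zero hf (le_of_not_gt fun h' => hu ⟨h', h.2⟩)]; rfl
        rw [lastTime] at h0
        rw [h0, zero_mul]
      · rfl

end

/-! ### Uniform sampling and reduction to one founder -/

section Sampling

variable {n x : ℕ} {s : ℝ≥0∞}

lemma measurableSet_mem_population (x : ℕ) (t : ℝ) (v : Indiv) :
    MeasurableSet {g | v ∈ population x g t} := by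
  simp only [population_eq]
  exact measurableSet_mem_forest (by fun_prop) measurable_const x v

/-- The coalescence times of the first individual of `v` with the others. -/
noncomputable def coalescenceTimes (x : ℕ) (t : ℝ) (v : Fin (n + 1) → Indiv) (g : Marks) :
    Fin n → EReal :=
  fun k => coalescenceTime x g t (v 0) (v k.succ)

lemma measurable_coalescenceTimes (x : ℕ) (t : ℝ) (v : Fin (n + 1) → Indiv) :
    Measurable (coalescenceTimes x t v) :=
  measurable_pi_lambda _ fun _ => measurable_coalescenceTime x t _ _

/-- Individuals with different founders have coalescence time `⊤`, where `f` vanishes, so only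
samples within one tree remain. -/
lemma sampleSum_population {f : (Fin n → EReal) → ℝ≥0∞} (hf : Increasing f) (g : Marks) (t : ℝ) :
    sampleSum s (population x g t) (fun v => f (coalescenceTimes x t v g)) =
      ∑ j ∈ Finset.range x, ∏ i ∈ Finset.range x,
        if i = j then treeSum s t f (fun l => g (j, l))
        else weight s (Tree.alive (fun l => g (i, l)) t) := by
  rw [population_eq, forest,
    sampleSum_slices_same (S := fun j => Tree.alive (fun l => g (j, l)) t)]
  · refine Finset.sum_congr rfl fun j hj => Finset.prod_congr rfl fun i _ => ?_
    have : ∀ q : Fin (n + 1) → List ℕ, coalescenceTimes x t (fun k => (j, q k)) g =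
        Tree.coals (fun l => g (j, l)) t q := fun q =>
      funext fun k => coalescenceTime_same g t (Finset.mem_range.1 hj) _ _
    simp only [this]
    rfl
  · intro v hv k
    refine Fin.cases rfl (fun k => ?_) k
    by_contra hne
    have h1 := ((hf _ hv).2 k).2
    have h2 : coalescenceTimes x t v g k = ⊤ :=
      coalescenceTime_eq_top g t (fun h => absurd h.symm hne) (v 0).2 (v k.succ).2
    rw [h2] at h1
    exact lt_irrefl _ h1

lemma ncard_injective {β : Type*} {S : Set β} (hS : S.Finite) (m : ℕ) :
    {v : Fin m → β | Function.Injective v ∧ ∀ k, v k ∈ S}.ncard = S.ncard.descFactorial m := by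
  classical
  have := hS.fintype
  let e : (Fin m ↪ S) ≃ {v : Fin m → β | Function.Injective v ∧ ∀ k, v k ∈ S} :=
    { toFun := fun v => ⟨fun k => v k, Subtype.val_injective.comp v.injective, fun k => (v k).2⟩
      invFun := fun v => ⟨fun k => ⟨v.1 k, v.2.2 k⟩, fun i j h => v.2.1 (congrArg Subtype.val h)⟩
      left_inv := fun v => rfl
      right_inv := fun v => rfl }
  rw [← Nat.card_coe_set_eq, ← Nat.card_congr e, Nat.card_eq_fintype_card, Fintype.card_embedding_eq,
    Fintype.card_fin, ← Nat.card_eq_fintype_card, Nat.card_coe_set_eq]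

/-- A uniform sample turns the factorial moment weight into a sum over all samples. -/
lemma lintegral_uniformSample {μ : Measure ℕ} {Ω : Type*} [MeasurableSpace Ω] {P : Measure Ω}
    [IsProbabilityMeasure P] {G : Ω → Marks} (hG : HasLaw G (markLaw μ) P) {t : ℝ} {m : ℕ}
    (hm : 1 ≤ m) {σ : Ω → Fin m → Indiv} (hσ : IsUniformSample P x G t m σ)
    {Φ : (Fin m → Indiv) → Marks → ℝ≥0∞} (hΦ : ∀ v, Measurable (Φ v)) {s : ℝ} (hs : 0 ≤ s) :
    ∫⁻ ω, Φ (σ ω) (G ω) * ENNReal.ofReal (((popSize x (G ω) t).descFactorial m : ℝ) *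
      s ^ (popSize x (G ω) t - m)) ∂P =
    ∫⁻ g, sampleSum (ENNReal.ofReal s) (population x g t) (fun v => Φ v g) ∂markLaw μ := by
  classical
  have hpop := measurableSet_mem_population x t
  let W : Marks → ℝ≥0∞ := fun g => ENNReal.ofReal (((popSize x g t).descFactorial m : ℝ) *
      s ^ (popSize x g t - m))
  -- The law of the sample is prescribed only on this set. Off it the weight vanishes: an infinite
  -- population has `ncard` 0 and `1 ≤ m`.
  let good : Set Marks := {g | (population x g t).Finite ∧ m ≤ popSize x g t}
  have hW : Measurable W := by
    have := measurable_ite_finite hpop (fun z => ENNReal.ofReal ((z.descFactorial m : ℝ) *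
      s ^ (z - m))) 0
    convert this using 2 with g
    split_ifs with h
    · rfl
    · simp only [W, popSize]
      rw [Set.Infinite.ncard h, Nat.descFactorial_of_lt (by omega)]
      simp
  have hgood : MeasurableSet good := by
    have := measurable_ite_finite hpop (fun z => m ≤ z) False
    have h2 := this (MeasurableSet.singleton True)
    convert h2 using 1
    ext g
    simp only [good, popSize, Set.mem_ofPred_eq, Set.mem_preimage, Set.mem_singleton_iff,
      eq_iff_iff, iff_true]
    by_cases h : (population x g t).Finite <;> simp [h]
  have hWgood : ∀ g, g ∉ good → W g = 0 := by
    intro g hg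
    simp only [W]
    rw [Nat.descFactorial_of_lt]
    · simp
    · by_contra! h
      refine hg ⟨?_, h⟩
      by_contra hinf
      rw [popSize, Set.Infinite.ncard hinf] at h
      omega
  -- On `good` this is the conditional probability, given the marks, that the sample equals `v`.
  let ρ : (Fin m → Indiv) → Marks → ℝ≥0∞ := fun v g =>
    if Function.Injective v ∧ ∀ k, v k ∈ population x g t then
      (if (population x g t).Finite then ((population x g t).ncard.descFactorial m : ℝ≥0∞)⁻¹ else 0)
    else 0
  have hρ : ∀ v, Measurable (ρ v) := by
    intro v
    refine Measurable.ite ?_ (measurable_ite_finite hpop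
      (fun z => ((z.descFactorial m : ℕ) : ℝ≥0∞)⁻¹) 0) measurable_const
    have : {g | Function.Injective v ∧ ∀ k, v k ∈ population x g t} =
        {_g | Function.Injective v} ∩ ⋂ k, {g | v k ∈ population x g t} := by ext; simp
    rw [this]
    exact MeasurableSet.inter (.const _) (.iInter fun k => hpop _)
  have hlaw : ∀ v, ((P.restrict {ω | σ ω = v}).map G).restrict good =
      ((markLaw μ).restrict good).withDensity (ρ v) := by
    intro v
    ext B hB
    have hBg := hB.inter hgood
    have hae : AEMeasurable G (P.restrict {ω | σ ω = v}) := hG.aemeasurable.restrict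
    rw [Measure.restrict_apply hB, Measure.map_apply_of_aemeasurable hae hBg,
      Measure.restrict_apply' (hσ.measurableSet_eq v), withDensity_apply _ hB,
      Measure.restrict_restrict hB]
    have := hσ.cond_law (B ∩ good) hBg (fun g hg => hg.2) v
    rw [hG.map_eq] at this
    refine Eq.trans this (setLIntegral_congr_fun hBg fun g hg => ?_)
    have hfin : (population x g t).Finite := hg.2.1
    have hcard : (samples x g t m).ncard = (population x g t).ncard.descFactorial m :=
      ncard_injective hfin m
    simp only [ρ, Set.indicator, hcard, if_pos hfin]
    exact if_congr Iff.rfl rfl rfl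
  have hterm : ∀ v, ∫⁻ ω in {ω | σ ω = v}, Φ (σ ω) (G ω) * W (G ω) ∂P =
      ∫⁻ g, ρ v g * (Φ v g * W g) ∂markLaw μ := by
    intro v
    have hm' : Measurable fun g => Φ v g * W g := (hΦ v).mul hW
    have h0 : ∀ g, g ∉ good → Φ v g * W g = 0 := fun g hg => by rw [hWgood g hg, mul_zero]
    have hind : good.indicator (fun g => Φ v g * W g) = fun g => Φ v g * W g :=
      Set.indicator_eq_self.2 fun g hg => by
        by_contra h
        exact hg (h0 g h)
    have hind2 : good.indicator (fun g => ρ v g * (Φ v g * W g)) =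
        fun g => ρ v g * (Φ v g * W g) :=
      Set.indicator_eq_self.2 fun g hg => by
        by_contra h
        exact hg (by simp [h0 g h])
    calc ∫⁻ ω in {ω | σ ω = v}, Φ (σ ω) (G ω) * W (G ω) ∂P
        = ∫⁻ ω in {ω | σ ω = v}, Φ v (G ω) * W (G ω) ∂P :=
          setLIntegral_congr_fun (hσ.measurableSet_eq v) fun ω hω => by
            rw [show σ ω = v from hω]
      _ = ∫⁻ g, Φ v g * W g ∂((P.restrict {ω | σ ω = v}).map G) :=
          (lintegral_map' hm'.aemeasurable hG.aemeasurable.restrict).symm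
      _ = ∫⁻ g in good, Φ v g * W g ∂((P.restrict {ω | σ ω = v}).map G) := by
          rw [← lintegral_indicator hgood, hind]
      _ = ∫⁻ g in good, ρ v g * (Φ v g * W g) ∂markLaw μ := by
          rw [hlaw v, lintegral_withDensity_eq_lintegral_mul _ (hρ v) hm']
          rfl
      _ = _ := by rw [← lintegral_indicator hgood, hind2]
  -- There are countably many possible samples, so the integral is split according to the value of
  -- `σ`.
  have huniv : (⋃ v, {ω | σ ω = v}) = Set.univ := by ext; simp
  calc ∫⁻ ω, Φ (σ ω) (G ω) * W (G ω) ∂P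
      = ∑' v, ∫⁻ ω in {ω | σ ω = v}, Φ (σ ω) (G ω) * W (G ω) ∂P := by
        rw [← lintegral_iUnion hσ.measurableSet_eq, huniv, Measure.restrict_univ]
        intro v w hvw
        refine Set.disjoint_left.2 fun ω h1 h2 => hvw ?_
        exact Eq.trans (Eq.symm h1) h2
    _ = ∫⁻ g, ∑' v, ρ v g * (Φ v g * W g) ∂markLaw μ := by
        rw [lintegral_tsum (f := fun v g => ρ v g * (Φ v g * W g))
          fun v => ((hρ v).mul ((hΦ v).mul hW)).aemeasurable]
        exact tsum_congr hterm
    _ = _ := by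
        refine lintegral_congr fun g => ?_
        rw [sampleSum]
        refine tsum_congr fun v => ?_
        by_cases hv : Function.Injective v ∧ ∀ k, v k ∈ population x g t
        swap
        · simp only [ρ, if_neg hv, zero_mul]
        by_cases hfin : (population x g t).Finite
        swap
        · simp only [ρ, if_neg hfin, if_pos hv, zero_mul]
          rw [weight_diff_range_of_infinite hfin, mul_zero]
        simp only [ρ, if_pos hfin, if_pos hv, W, popSize]
        rw [weight_diff_range hfin hv.1 hv.2, ENNReal.ofReal_mul (by positivity),
          ENNReal.ofReal_natCast, ENNReal.ofReal_pow hs]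
        have hle : m ≤ (population x g t).ncard := by
          have h1 : Set.range v ⊆ population x g t := by rintro _ ⟨k, rfl⟩; exact hv.2 k
          have h2 := Set.ncard_le_ncard h1 hfin
          rwa [← Set.image_univ, Set.ncard_image_of_injective _ hv.1, Set.ncard_univ,
            Nat.card_fin] at h2
        have hne : ((population x g t).ncard.descFactorial m : ℝ≥0∞) ≠ 0 := by
          rw [Nat.cast_ne_zero, Ne, Nat.descFactorial_eq_zero_iff_lt]
          omega
        calc _ = Φ v g * (((population x g t).ncard.descFactorial m : ℝ≥0∞)⁻¹ *
              ((population x g t).ncard.descFactorial m : ℝ≥0∞)) *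
              ENNReal.ofReal s ^ ((population x g t).ncard - m) := by ring
          _ = _ := by rw [ENNReal.inv_mul_cancel hne (ENNReal.natCast_ne_top _), mul_one]

variable {μ : Measure ℕ} [IsFiniteMeasure μ] [NeZero μ]

lemma measurePreserving_curry_markLaw :
    MeasurePreserving (fun (g : Marks) j l => g (j, l)) (markLaw μ) (forestLaw (nodeLaw μ)) :=
  measurePreserving_curry (nodeLaw μ)

/-- The branching property: only samples with a common founder contribute. -/
lemma lintegral_sampleSum_population {f : (Fin n → EReal) → ℝ≥0∞} (hfm : Measurable f)
    (hf : Increasing f) (t : ℝ) :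
    ∫⁻ g, sampleSum s (population x g t) (fun v => f (coalescenceTimes x t v g)) ∂markLaw μ =
      x * genFun (nodeLaw μ) s t ^ (x - 1) * meanSum (nodeLaw μ) s t f := by
  simp only [sampleSum_population hf]
  have hA := measurable_treeSum_right (s := s) hfm t
  have hW := measurable_weight_alive_right (s := s) t
  rw [genFun, meanSum, ← lintegral_forest_same (nodeLaw μ) x hA hW,
    ← measurePreserving_curry_markLaw.lintegral_comp]
  refine Finset.measurable_fun_sum _ fun j _ => Finset.measurable_fun_prod _ fun i _ => ?_
  split_ifs
  · exact hA.comp (measurable_pi_apply j)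
  · exact hW.comp (measurable_pi_apply i)

lemma lintegral_weight_population (t : ℝ) :
    ∫⁻ g, weight s (population 1 g t) ∂markLaw μ = genFun (nodeLaw μ) s t := by
  have hW := measurable_weight_alive_right (s := s) t
  simp only [population_eq, forest]
  have h : ∀ g : Marks, weight s {v : ℕ × List ℕ | v.1 < 1 ∧
      v.2 ∈ Tree.alive (fun l => g (v.1, l)) t} = weight s (Tree.alive (fun l => g (0, l)) t) := by
    intro g
    rw [weight_slices 1 fun j => Tree.alive (fun l => g (j, l)) t]
    simp
  simp only [h]
  have h1 := measurePreserving_curry_markLaw (μ := μ)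
  have h2 : MeasurePreserving (fun h : ℕ → Tree => h 0) (forestLaw (nodeLaw μ))
      (treeLaw (nodeLaw μ)) :=
    measurePreserving_eval_infinitePi (fun _ : ℕ => treeLaw (nodeLaw μ)) 0
  exact (h2.comp h1).lintegral_comp hW

end Sampling

/-! ### Identification with ψ, its derivative, and the offspring rate -/

section GeneratingFunction

/-- Summing over one marked individual gives Z s^(Z-1), the derivative of s^Z; this is why `meanOne`
is the derivative of `psi`. -/
lemma sampleSum_one_eq {β : Type*} (s : ℝ≥0∞) (S : Set β) :
    sampleSum s S (fun _ : Fin 1 → β => 1) =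
      open Classical in if S.Finite then (S.ncard : ℝ≥0∞) * s ^ (S.ncard - 1) else 0 := by
  classical
  rw [sampleSum_one]
  by_cases hS : S.Finite
  · rw [if_pos hS, tsum_eq_sum (s := hS.toFinset) fun q hq => if_neg (by simpa using hq),
      Finset.sum_congr rfl (g := fun _ => s ^ (S.ncard - 1)), Finset.sum_const, nsmul_eq_mul,
      Set.ncard_eq_toFinset_card _ hS]
    intro q hq
    have hq : q ∈ S := by simpa using hq
    rw [if_pos hq, weight, if_pos hS.sdiff, Set.ncard_sdiff_singleton_of_mem hq]
  · rw [if_neg hS, ENNReal.tsum_eq_zero]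
    intro q
    exact ite_eq_right_iff.2 fun _ => if_neg fun h => hS (h.of_sdiff (Set.finite_singleton q))

variable {μ : Measure ℕ} [IsFiniteMeasure μ] [NeZero μ]

instance : IsProbabilityMeasure (markLaw μ) := by
  have : IsProbabilityMeasure ((μ Set.univ)⁻¹ • μ) := inferInstance
  unfold markLaw
  infer_instance

lemma genFun_ne_top {s : ℝ≥0∞} (hs : s ≤ 1) (r : ℝ) : genFun (nodeLaw μ) s r ≠ ⊤ := by
  refine ne_top_of_le_ne_top ENNReal.one_ne_top ?_
  calc genFun (nodeLaw μ) s r ≤ ∫⁻ _, 1 ∂treeLaw (nodeLaw μ) :=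
        lintegral_mono fun T => weight_le_one hs _
    _ = 1 := by rw [lintegral_const, measure_univ, mul_one]

lemma psi_eq_toReal (r : ℝ) {s : ℝ} (hs : 0 ≤ s) :
    psi μ r s = (genFun (nodeLaw μ) (ENNReal.ofReal s) r).toReal := by
  classical
  have hm := measurable_ite_finite (measurableSet_mem_population 1 r) (fun z => s ^ z) 0
  rw [← lintegral_weight_population, psi, integral_eq_lintegral_of_nonneg_ae]
  · congr 1
    refine lintegral_congr fun g => ?_
    simp only [weight, popSize]
    split_ifs
    · exact ENNReal.ofReal_pow hs _
    · exact ENNReal.ofReal_zero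
  · refine ae_of_all _ fun g => ?_
    simp only [Pi.zero_apply]
    split_ifs <;> positivity
  · exact hm.aestronglyMeasurable

lemma deriv_psi_eq_toReal (r : ℝ) {s : ℝ} (hs0 : 0 ≤ s) (hs1 : s < 1) :
    deriv (psi μ r) s = (meanOne (nodeLaw μ) (ENNReal.ofReal s) r).toReal := by
  classical
  have hpop := measurableSet_mem_population 1 r
  -- The ball of radius (1 - s)/2 about `s` lies in |y| ≤ q < 1, which provides a constant
  -- dominating function, also when `s = 0`.
  set q : ℝ := (1 + s) / 2 with hq
  have hq0 : 0 ≤ q := by positivity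
  have hq1 : q < 1 := by linarith
  obtain ⟨C, hC, hCb⟩ := exists_pow_mul_pow_sub_le (ENNReal.ofReal_lt_one.2 hq1) 1
  have hbound : ∀ z : ℕ, (z : ℝ) * q ^ (z - 1) ≤ C.toReal := by
    intro z
    have := hCb z
    rw [pow_one, ← ENNReal.ofReal_natCast, ← ENNReal.ofReal_pow hq0,
      ← ENNReal.ofReal_mul (by positivity)] at this
    exact (ENNReal.ofReal_le_iff_le_toReal hC).1 this
  have hnhds : Metric.ball s ((1 - s) / 2) ∈ nhds s :=
    Metric.ball_mem_nhds s (by linarith)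
  have hderiv := (hasDerivAt_integral_of_dominated_loc_of_deriv_le (μ := markLaw μ)
    (F := fun y g => if (population 1 g r).Finite then y ^ (population 1 g r).ncard else 0)
    (F' := fun y g => if (population 1 g r).Finite then
      ((population 1 g r).ncard : ℝ) * y ^ ((population 1 g r).ncard - 1) else 0)
    (bound := fun _ => C.toReal) hnhds
    (.of_forall fun y => (measurable_ite_finite hpop (fun z => y ^ z) 0).aestronglyMeasurable)
    (Integrable.of_bound (C := 1)
      (measurable_ite_finite hpop (fun z => s ^ z) 0).aestronglyMeasurable
      (ae_of_all _ fun g => ?_))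
    (measurable_ite_finite hpop (fun z => (z : ℝ) * s ^ (z - 1)) 0).aestronglyMeasurable
    (ae_of_all _ fun g y hy => ?_) (integrable_const _) (ae_of_all _ fun g y _ => ?_)).2
  · rw [show psi μ r = fun y => ∫ g, (if (population 1 g r).Finite then
      y ^ (population 1 g r).ncard else 0) ∂markLaw μ from funext fun y => by
        simp only [psi, popSize], hderiv.deriv]
    have h1 := lintegral_sampleSum_population (n := 0) (x := 1) (μ := μ) (s := ENNReal.ofReal s)
      (f := fun _ => 1) measurable_const
      (fun τ _ => ⟨fun i => i.elim0, fun i => i.elim0⟩) r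
    rw [Nat.cast_one, one_mul, pow_zero, one_mul] at h1
    rw [meanOne, ← h1, integral_eq_lintegral_of_nonneg_ae]
    · congr 1
      refine lintegral_congr fun g => ?_
      rw [sampleSum_one_eq]
      split_ifs
      · rw [ENNReal.ofReal_mul (by positivity), ENNReal.ofReal_natCast, ENNReal.ofReal_pow hs0]
      · exact ENNReal.ofReal_zero
    · refine ae_of_all _ fun g => ?_
      simp only [Pi.zero_apply]
      split_ifs <;> positivity
    · exact (measurable_ite_finite hpop
        (fun z => (z : ℝ) * s ^ (z - 1)) 0).aestronglyMeasurable
  · split_ifs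
    · rw [norm_pow, Real.norm_of_nonneg hs0]
      exact pow_le_one₀ hs0 hs1.le
    · simp
  · have hyq : |y| ≤ q := by
      rw [Metric.mem_ball, Real.dist_eq] at hy
      have h1 := abs_sub_abs_le_abs_sub y s
      rw [abs_of_nonneg hs0] at h1
      linarith
    split_ifs
    · rw [norm_mul, norm_pow, Real.norm_natCast, Real.norm_eq_abs]
      refine le_trans ?_ (hbound (population 1 g r).ncard)
      gcongr
    · simp
  · split_ifs
    · exact hasDerivAt_pow _ _
    · exact hasDerivAt_const _ _

lemma meanOne_ne_top {s : ℝ≥0∞} (hs : s < 1) (r : ℝ) : meanOne (nodeLaw μ) s r ≠ ⊤ := by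
  obtain ⟨C, hC, h⟩ := exists_meanSum_le hs 0 (nodeLaw μ)
  exact ne_top_of_le_ne_top hC (h r _ fun _ => le_rfl)

lemma rateTwo_ne_top {s : ℝ≥0∞} (hs : s < 1) {r : ℝ} (hr : 0 ≤ r) : rateTwo μ s r ≠ ⊤ := by
  obtain ⟨C, hC, h⟩ := exists_rate_le (μ := μ) hs hr
  exact ne_top_of_le_ne_top hC (h r hr le_rfl).2

lemma tsum_psi_eq_toReal (r : ℝ) {s : ℝ} (hs0 : 0 ≤ s) (hs1 : s < 1) :
    ∑' k : ℕ, (k : ℝ) * ((k : ℝ) - 1) * μ.real {k} * psi μ r s ^ (k - 2) =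
      (rateTwo μ (ENNReal.ofReal s) r).toReal := by
  have hs : ENNReal.ofReal s < 1 := ENNReal.ofReal_lt_one.2 hs1
  have hg := genFun_ne_top (μ := μ) hs.le r
  rw [rateTwo, ENNReal.tsum_toReal_eq fun k => by finiteness]
  refine tsum_congr fun k => ?_
  rw [psi_eq_toReal r hs0]
  simp only [ENNReal.toReal_mul, ENNReal.toReal_pow, ENNReal.toReal_natCast, measureReal_def]
  -- The truncated and the real `k - 1` differ only at `k = 0`, where the factor `k` vanishes.
  rcases k with _ | k
  · simp
  · push_cast [Nat.add_sub_cancel]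
    ring

end GeneratingFunction

end BGW

/-! ### The joint density of the coalescence times -/

open BGW in
theorem theorem3
    (μ : Measure ℕ) [IsFiniteMeasure μ] (hμ0 : 0 < μ {0}) (hμ1 : μ {1} = 0)
    (x n : ℕ) (hn : 1 ≤ n) (t : ℝ) (ht : 0 < t)
    {Ω : Type*} [MeasurableSpace Ω] (P : Measure Ω) [IsProbabilityMeasure P]
    (G : Ω → BGW.Marks) (hG : HasLaw G (BGW.markLaw μ) P)
    (σ : Ω → Fin (n + 1) → BGW.Indiv) (hσ : BGW.IsUniformSample P x G t (n + 1) σ)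
    (s : ℝ) (hs0 : 0 ≤ s) (hs1 : s < 1)
    (A : Set (Fin n → ℝ)) (hA : MeasurableSet A)
    (hAt : ∀ τ ∈ A, StrictMono τ ∧ ∀ i, 0 < τ i ∧ τ i ≤ t) :
    ∫⁻ ω in {ω | ∃ τ ∈ A, ∀ k : Fin n,
          BGW.coalescenceTime x (G ω) t (σ ω 0) (σ ω k.succ) = (τ k : EReal)},
        ENNReal.ofReal (((BGW.popSize x (G ω) t).descFactorial (n + 1) : ℝ) *
          s ^ (BGW.popSize x (G ω) t - (n + 1))) ∂P
      = ∫⁻ τ in A, ENNReal.ofReal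
          ((x : ℝ) * deriv (BGW.psi μ t) s * BGW.psi μ t s ^ (x - 1) *
            ∏ i : Fin n, (deriv (BGW.psi μ (τ i)) s *
              ∑' k : ℕ, (k : ℝ) * ((k : ℝ) - 1) * μ.real {k} *
                BGW.psi μ (τ i) s ^ (k - 2))) := by
  classical
  have : NeZero μ := ⟨by rintro rfl; simp at hμ0⟩
  have hs : ENNReal.ofReal s < 1 := ENNReal.ofReal_lt_one.2 hs1
  -- The set `A` seen among extended real vectors; its indicator is the test function `f`.
  let E : Set (Fin n → EReal) := {τ | ∃ τ' ∈ A, ∀ k, τ k = (τ' k : EReal)}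
  have hE : MeasurableSet E := by
    have h1 : E = (⋂ k, {τ | τ k ≠ ⊤} ∩ {τ | τ k ≠ ⊥}) ∩ (fun τ k => (τ k).toReal) ⁻¹' A := by
      ext τ
      simp only [E, Set.mem_ofPred_eq, Set.mem_inter_iff, Set.mem_iInter, Set.mem_preimage]
      constructor
      · rintro ⟨τ', hτ', h⟩
        refine ⟨fun k => by simp [h k], ?_⟩
        simpa [h] using hτ'
      · rintro ⟨h, hτ⟩
        exact ⟨_, hτ, fun k => (EReal.coe_toReal (h k).1 (h k).2).symm⟩
    rw [h1]
    refine MeasurableSet.inter (.iInter fun k => MeasurableSet.inter ?_ ?_) ?_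
    · exact (measurable_pi_apply k (MeasurableSet.singleton _)).compl
    · exact (measurable_pi_apply k (MeasurableSet.singleton _)).compl
    · exact (measurable_pi_lambda _ fun k => (measurable_pi_apply k).ereal_toReal) hA
  let f : (Fin n → EReal) → ℝ≥0∞ := E.indicator 1
  have hfm : Measurable f := measurable_one.indicator hE
  have hf : Increasing f := by
    intro τ hτ
    obtain ⟨τ', hτ', h⟩ := Set.mem_of_indicator_ne_zero hτ
    obtain ⟨h1, h2⟩ := hAt τ' hτ'
    refine ⟨fun i j hij => ?_, fun i => ?_⟩
    · rw [h i, h j]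
      exact EReal.coe_lt_coe_iff.2 (h1 hij)
    · rw [h i]
      exact ⟨EReal.coe_pos.2 (h2 i).1, EReal.coe_lt_top _⟩
  have hf1 : ∀ τ, f τ ≤ 1 := fun τ => Set.indicator_le_self' (fun _ _ => zero_le) τ
  have hfA : ∀ τ : Fin n → ℝ, f (fun i => (τ i : EReal)) = A.indicator 1 τ := by
    intro τ
    have : (fun i => (τ i : EReal)) ∈ E ↔ τ ∈ A := by
      constructor
      · rintro ⟨τ', hτ', h⟩
        have : τ = τ' := funext fun k => EReal.coe_eq_coe_iff.1 (h k)
        rwa [this]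
      · exact fun h => ⟨τ, h, fun _ => rfl⟩
    by_cases h : τ ∈ A
    · simp [f, h, this.2 h]
    · simp only [f]
      rw [Set.indicator_of_notMem h, Set.indicator_of_notMem (fun h' => h (this.1 h'))]
  -- Only null-measurability is available, since `G` is merely a.e. measurable.
  have hevent : NullMeasurableSet {ω | ∃ τ ∈ A, ∀ k : Fin n,
      coalescenceTime x (G ω) t (σ ω 0) (σ ω k.succ) = (τ k : EReal)} P := by
    have h1 : {ω | ∃ τ ∈ A, ∀ k : Fin n,
        coalescenceTime x (G ω) t (σ ω 0) (σ ω k.succ) = (τ k : EReal)} =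
        ⋃ v, {ω | σ ω = v} ∩ G ⁻¹' (coalescenceTimes x t v ⁻¹' E) := by
      ext ω
      simp only [Set.mem_iUnion, Set.mem_inter_iff, Set.mem_ofPred_eq, exists_eq_left']
      rfl
    rw [h1]
    exact .iUnion fun v => (hσ.measurableSet_eq v).nullMeasurableSet.inter
      (hG.aemeasurable.nullMeasurable (measurable_coalescenceTimes x t v hE))
  rw [← lintegral_indicator₀ hevent]
  calc _ = ∫⁻ ω, f (coalescenceTimes x t (σ ω) (G ω)) *
          ENNReal.ofReal (((popSize x (G ω) t).descFactorial (n + 1) : ℝ) *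
            s ^ (popSize x (G ω) t - (n + 1))) ∂P := by
        refine lintegral_congr fun ω => ?_
        by_cases h : coalescenceTimes x t (σ ω) (G ω) ∈ E
        · rw [Set.indicator_of_mem (by exact h)]
          simp only [f]
          rw [Set.indicator_of_mem h, Pi.one_apply, one_mul]
        · rw [Set.indicator_of_notMem (by exact h)]
          simp only [f]
          rw [Set.indicator_of_notMem h, zero_mul]
    _ = x * genFun (nodeLaw μ) (ENNReal.ofReal s) t ^ (x - 1) *
          meanSum (nodeLaw μ) (ENNReal.ofReal s) t f := by
        rw [← lintegral_sampleSum_population hfm hf t]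
        exact lintegral_uniformSample hG (by omega) hσ
          (Φ := fun v g => f (coalescenceTimes x t v g))
          (fun v => hfm.comp (measurable_coalescenceTimes x t v)) hs0
    _ = _ := by
        rw [meanSum_eq_lintegral hs ht hfm hf hf1, ← mul_assoc,
          ← lintegral_const_mul _ (measurable_density hfm t), ← lintegral_indicator hA]
        refine lintegral_congr fun τ => ?_
        rw [hfA]
        by_cases hτ : τ ∈ A
        · rw [Set.indicator_of_mem hτ, Set.indicator_of_mem hτ, if_pos fun i => ((hAt τ hτ).2 i).2,
            Pi.one_apply, one_mul]
          -- The offspring sums are rewritten first, while they are still expressed through `psi`.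
          simp only [tsum_psi_eq_toReal _ hs0 hs1]
          simp only [deriv_psi_eq_toReal _ hs0 hs1,
            psi_eq_toReal _ hs0, ← ENNReal.toReal_mul, ← ENNReal.toReal_pow,
            ← ENNReal.toReal_prod, ← ENNReal.toReal_natCast x]
          have hgt := genFun_ne_top (μ := μ) hs.le t
          have hDt := meanOne_ne_top (μ := μ) hs t
          have hprod : ∏ i, meanOne (nodeLaw μ) (ENNReal.ofReal s) (τ i) *
              rateTwo μ (ENNReal.ofReal s) (τ i) ≠ ⊤ :=
            ENNReal.prod_ne_top fun i _ => ENNReal.mul_ne_top (meanOne_ne_top hs _)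
              (rateTwo_ne_top hs ((hAt τ hτ).2 i).1.le)
          -- All factors are finite because s < 1 and the times are nonnegative, so no information
          -- is lost in passing to real numbers.
          rw [ENNReal.ofReal_toReal (by finiteness)]
          ring
        · rw [Set.indicator_of_notMem hτ, Set.indicator_of_notMem hτ, zero_mul, ite_self, mul_zero]
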